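/- Throughout, a \emph{topos} is an elementary topos: a category with chosen finite products, all finite limits, chosen exponentials and a subobject classifier $\mathrm{true}\colon 1\to\Omega$. A functor $L\colon\mathcal E\to\mathcal F$ between toposes is \emph{logical} if it preserves finite products, exponentials (the canonical maps $L(B^A)\to L(B)^{L(A)}$ are isomorphisms) and the subobject classifier ($L(\mathrm{true})$ is a subobject classifier of $\mathcal F$). An \emph{internal commutative quantale} $(Q,\otimes,k,\bigvee)$ in a topos $\mathcal E$ is an object $Q$ with morphisms $\otimes\colon Q\times Q\to Q$, $k\colon 1\to Q$, $\bigvee\colon\Omega^Q\to Q$ and an order relation ${\le}\colon Q\times Q\to\Omega$ satisfying, in the internal language of $\mathcal E$: $\le$ is a partial order for which $\bigvee S$ is the least upper bound of $S$; $(Q,\otimes,k)$ is a commutative monoid; $a\otimes\bigvee S=\bigvee\{a\otimes s\mid s\in S\}$ and $\bigvee S\otimes a=\bigvee\{s\otimes a\mid s\in S\}$. For a logical functor $L\colon\mathcal E\to\mathcal F$, $LQ$ denotes the object $L(Q)$ with the images of these morphisms, transported along the canonical isomorphisms $L(Q\times Q)\cong LQ\times LQ$, $L(1)\cong 1$, $L(\Omega)\cong\Omega$,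 $L(\Omega^Q)\cong\Omega^{LQ}$. Let $(\Sigma,E)$ be an algebraic signature: a set of operation symbols of finite arity and a set of equations between terms, each in finitely many variables. The category $\mathbf{Rel}^{\mathcal E}_{(\Sigma,E)}(Q)$ has as objects the $(\Sigma,E)$-algebras in $\mathcal E$, and as morphisms $A\to B$ the algebraic $Q$-relations, i.e. the morphisms $R\colon A\times B\to Q$ of $\mathcal E$ such that, in the internal language, $R(a_1,b_1)\otimes\dots\otimes R(a_n,b_n)\le R(\sigma(a_1,\dots,a_n),\sigma(b_1,\dots,b_n))$ for every $n$-ary $\sigma\in\Sigma$. The identity on $A$ is $(a,a')\mapsto\bigvee\{k\mid a=a'\}$ and the composite of $R\colon A\to B$ and $S\colon B\to C$ is $(a,c)\mapsto\bigvee\{R(a,b)\otimes S(b,c)\mid b\in B\}$. It is a symmetric monoidal category: $A\otimes B$ is the product algebra $A\times B$, the unit is the terminal algebra, $(R\otimes R')((a,a'),(b,b'))=R(a,b)\otimes R'(a',b')$, and the structural isomorphisms are the graphs $(a,b)\mapsto\bigvee\{k\mid f(a)=b\}$ of the structural isomorphisms $f$ of the finite products of $\mathcal E$. \textbf{Theorem.}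 Let $(\Sigma,E)$ be an algebraic signature. \begin{enumerate} \item If $L\colon\mathcal E\to\mathcal F$ is a logical functor between toposes and $Q$ is an internal commutative quantale in $\mathcal E$, then $LQ$ is an internal commutative quantale in $\mathcal F$. \item To every such $L$ and $Q$ one can assign a (strong) symmetric monoidal functor \[L^*\colon \mathbf{Rel}^{\mathcal E}_{(\Sigma,E)}(Q)\longrightarrow\mathbf{Rel}^{\mathcal F}_{(\Sigma,E)}(LQ)\] which sends an algebra $A$ to $L(A)$, with the operations $L(A)^n\cong L(A^n)\to L(A)$, and an algebraic $Q$-relation $R\colon A\times B\to Q$ to $L(A)\times L(B)\xrightarrow{\ \kappa\ }L(A\times B)\xrightarrow{\ L(R)\ }L(Q)$, where $\kappa$ is the canonical isomorphism. \item The assignment $L\mapsto L^*$ is functorial: one can choose the symmetric monoidal structures in (2) so that, as symmetric monoidal functors, $(\mathrm{id}_{\mathcal E})^*=\mathrm{id}$, and $(K\circ L)^*=K^*\circ L^*$ for all logical functors $L\colon\mathcal E\to\mathcal F$ and $K\colon\mathcal F\to\mathcal G$ (here $\mathrm{id}_{\mathcal E}Q=Q$ and $(KL)Q=K(LQ)$).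 \end{enumerate} -/

import Mathlib

open CategoryTheory MonoidalCategory CartesianMonoidalCategory
open CategoryTheory.Limits hiding prodComparison terminalComparison

universe w v u v₁ u₁ v₂ u₂ v₃ u₃

namespace ToposRel

noncomputable section

/-- An elementary topos: a category with (chosen) finite products, finite limits, (chosen)
exponentials and a subobject classifier. -/
class ElementaryTopos (E : Type u) [Category.{v} E] extends CartesianMonoidalCategory E,
  MonoidalClosed E, HasFiniteLimits E, HasSubobjectClassifier E

open HasSubobjectClassifier

section Logic

variable {E : Type u} [Category.{v} E] [ElementaryTopos E]

/-- The truth value "true", at stage `X`. -/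
def tt (X : E) : X ⟶ Ω E := Subobject.Classifier.χ₀ _ X ≫ truth E

/-- The power object of `A`. -/
abbrev Pow (A : E) : E := (ihom A).obj (Ω E)

/-- The truth value of `a ∈ S`, at stage `X`. -/
def mem {A X : E} (a : X ⟶ A) (S : X ⟶ Pow A) : X ⟶ Ω E :=
  lift a S ≫ (ihom.ev A).app (Ω E)

/-- The internal subset `{a | P(a, x)}` of `A`, depending on the parameter `x`. -/
def comprehension {A X : E} (P : A ⊗ X ⟶ Ω E) : X ⟶ Pow A := MonoidalClosed.curry P

@[simp]
lemma comp_tt {X Y : E} (f : X ⟶ Y) : f ≫ tt Y = tt X := by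
  unfold tt
  rw [← Category.assoc]
  congr 1
  exact Subsingleton.elim _ _

lemma comp_mem {A X Y : E} (f : Y ⟶ X) (a : X ⟶ A) (S : X ⟶ Pow A) :
    f ≫ mem a S = mem (f ≫ a) (f ≫ S) := by
  simp [mem, ← Category.assoc]

lemma mem_comprehension {A X Y : E} (P : A ⊗ X ⟶ Ω E) (a : Y ⟶ A) (f : Y ⟶ X) :
    mem a (f ≫ comprehension P) = lift a f ≫ P := by
  have : lift a (f ≫ comprehension P) = lift a f ≫ (A ◁ comprehension P) := by simp
  unfold mem
  rw [this, Category.assoc, ← MonoidalClosed.uncurry_eq, comprehension,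
    MonoidalClosed.uncurry_curry]

lemma comp_chi_eq_tt_iff {U X T : E} (m : U ⟶ X) [Mono m] (p : T ⟶ X) :
    p ≫ χ m = tt T ↔ ∃ l : T ⟶ U, l ≫ m = p := by
  constructor
  · intro h
    exact ⟨(isPullback_χ m).lift p (Subobject.Classifier.χ₀ _ T) h,
      (isPullback_χ m).lift_fst _ _ _⟩
  · rintro ⟨l, rfl⟩
    rw [Category.assoc, HasSubobjectClassifier.comm, ← Category.assoc]
    unfold tt
    congr 1
    exact Subsingleton.elim _ _

lemma omega_ext {X : E} {a b : X ⟶ Ω E}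
    (h : ∀ (T : E) (p : T ⟶ X), p ≫ a = tt T ↔ p ≫ b = tt T) : a = b := by
  have key : ∀ c : X ⟶ Ω E, (∀ (T : E) (p : T ⟶ X), p ≫ a = tt T ↔ p ≫ c = tt T) →
      c = χ (equalizer.ι a (tt X)) := by
    intro c hc
    apply HasSubobjectClassifier.unique
    refine ⟨⟨?_⟩, ⟨PullbackCone.IsLimit.mk _ (fun s => equalizer.lift s.fst ?_) ?_ ?_ ?_⟩⟩
    · refine ((hc _ _).1 ?_).trans rfl
      rw [equalizer.condition, comp_tt]
    · rw [comp_tt, hc, s.condition]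
      unfold tt
      congr 1
      exact Subsingleton.elim _ _
    · intro s; simp
    · intro s; exact Subsingleton.elim _ _
    · intro s l h1 _
      rw [← cancel_mono (equalizer.ι a (tt X)), h1]
      simp
  rw [key a (fun _ _ => Iff.rfl), ← key b h]

/-- Universal quantification along `v`: the subobject `{z | ∀ w, v w = z → φ w}`. -/
lemma exists_forall {W Z : E} (f : W ⟶ Z) (φ : W ⟶ Ω E) :
    ∃ (N : E) (n : N ⟶ Z) (_ : Mono n), ∀ (V : E) (e : V ⟶ Z),
      (∃ l : V ⟶ N, l ≫ n = e) ↔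
        ∀ (T : E) (t : T ⟶ W) (a : T ⟶ V), t ≫ f = a ≫ e → t ≫ φ = tt T := by
  have m1 : Mono (lift (𝟙 W) f) := mono_lift_of_mono_left _ _
  let k := equalizer.ι φ (tt W)
  have m2 : Mono (k ≫ lift (𝟙 W) f) := mono_comp _ _
  let g1 := comprehension (χ (lift (𝟙 W) f))
  let g2 := comprehension (χ (k ≫ lift (𝟙 W) f))
  have h1 : ∀ {T : E} (t : T ⟶ W) (z : T ⟶ Z),
      lift t z ≫ χ (lift (𝟙 W) f) = tt T ↔ t ≫ f = z := by
    intro T t z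
    rw [comp_chi_eq_tt_iff]
    constructor
    · rintro ⟨l, hl⟩
      have a1 := congrArg (· ≫ fst _ _) hl
      have a2 := congrArg (· ≫ snd _ _) hl
      simp at a1 a2
      rw [← a1, a2]
    · rintro rfl
      exact ⟨t, by simp⟩
  have h2 : ∀ {T : E} (t : T ⟶ W) (z : T ⟶ Z),
      lift t z ≫ χ (k ≫ lift (𝟙 W) f) = tt T ↔ t ≫ f = z ∧ t ≫ φ = tt T := by
    intro T t z
    rw [comp_chi_eq_tt_iff]
    constructor
    · rintro ⟨l, hl⟩
      have a1 := congrArg (· ≫ fst _ _) hl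
      have a2 := congrArg (· ≫ snd _ _) hl
      simp at a1 a2
      rw [← a1]
      refine ⟨by simpa using a2, ?_⟩
      rw [Category.assoc, equalizer.condition]
      simp
    · rintro ⟨rfl, h⟩
      exact ⟨equalizer.lift t (by simpa using h), by simp [k]⟩
  refine ⟨equalizer g1 g2, equalizer.ι g1 g2, inferInstance, fun V e => ?_⟩
  trans e ≫ g1 = e ≫ g2
  · constructor
    · rintro ⟨l, rfl⟩
      rw [Category.assoc, Category.assoc, equalizer.condition]
    · intro h
      exact ⟨equalizer.lift e h, by simp⟩
  · constructor
    · intro h T t a hta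
      have := mem_comprehension (χ (lift (𝟙 W) f)) t (a ≫ e)
      have h' : mem t ((a ≫ e) ≫ g1) = mem t ((a ≫ e) ≫ g2) := by
        simp only [Category.assoc, h]
      rw [mem_comprehension, mem_comprehension, (h1 _ _).2 hta] at h'
      exact ((h2 _ _).1 h'.symm).2
    · intro h
      have hc : ∀ P : W ⊗ Z ⟶ Ω E,
          e ≫ comprehension P = comprehension ((W ◁ e) ≫ P) := by
        intro P
        exact (MonoidalClosed.curry_natural_left _ _).symm
      rw [hc, hc]
      congr 1
      refine omega_ext fun T p => ?_
      have hp : p ≫ (W ◁ e) = lift (p ≫ fst _ _) ((p ≫ snd _ _) ≫ e) := by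
        ext <;> simp
      rw [← Category.assoc, ← Category.assoc, hp, h1, h2]
      exact ⟨fun q => ⟨q, h _ _ _ q⟩, fun q => q.1⟩

/-- The image of `h` is `{z | ∀ S, (∀ i, h i ∈ S) → z ∈ S}`. -/
lemma exists_image {I Z : E} (h : I ⟶ Z) :
    ∃ (N : E) (n : N ⟶ Z) (_ : Mono n), (∃ l : I ⟶ N, l ≫ n = h) ∧
      ∀ (M : E) (m : M ⟶ Z) [Mono m], (∃ l : I ⟶ M, l ≫ m = h) → ∃ l : N ⟶ M, l ≫ m = n := by
  let p : Pow Z ⟶ Pow I := comprehension ((h ▷ Pow Z) ≫ (ihom.ev Z).app (Ω E))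
  let q : Pow Z ⟶ Pow I := comprehension (tt _)
  let ι := equalizer.ι p q
  have hp : ∀ {T : E} (a : T ⟶ I) (S : T ⟶ Pow Z), mem a (S ≫ p) = mem (a ≫ h) S := by
    intro T a S
    rw [mem_comprehension, ← Category.assoc, lift_whiskerRight]
    rfl
  have hq : ∀ {T : E} (a : T ⟶ I) (S : T ⟶ Pow Z), mem a (S ≫ q) = tt T := by
    intro T a S
    rw [mem_comprehension, comp_tt]
  obtain ⟨N, n, hn, H⟩ := exists_forall (fst Z (equalizer p q)) (mem (fst _ _) (snd _ _ ≫ ι))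
  refine ⟨N, n, hn, (H _ _).2 ?_, ?_⟩
  · intro T t a hta
    rw [comp_mem, hta, ← hp, ← Category.assoc, Category.assoc, equalizer.condition,
      ← Category.assoc, hq]
  · rintro M m hm ⟨l, hl⟩
    let S : 𝟙_ E ⟶ Pow Z := comprehension (fst _ _ ≫ χ m)
    have hS : S ≫ p = S ≫ q := by
      have e1 : S ≫ p = comprehension ((I ◁ S) ≫ (h ▷ Pow Z) ≫ (ihom.ev Z).app (Ω E)) :=
        (MonoidalClosed.curry_natural_left _ _).symm
      have e2 : S ≫ q = comprehension ((I ◁ S) ≫ tt _) :=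
        (MonoidalClosed.curry_natural_left _ _).symm
      rw [e1, e2, comp_tt]
      congr 1
      have e3 : (I ◁ S) ≫ (h ▷ Pow Z) = lift (fst _ _ ≫ h) (snd _ _ ≫ S) := by
        ext <;> simp
      rw [← Category.assoc, e3]
      change mem _ _ = _
      rw [mem_comprehension, ← Category.assoc, lift_fst, ← hl, comp_chi_eq_tt_iff]
      exact ⟨fst _ _ ≫ l, by simp⟩
    have := (H N n).1 ⟨𝟙 N, by simp⟩ N (lift n (toUnit _ ≫ equalizer.lift S hS)) (𝟙 N) (by simp)
    rw [comp_mem] at this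
    simp only [lift_fst, ← Category.assoc, lift_snd] at this
    have e4 : (toUnit N ≫ equalizer.lift S hS) ≫ ι = toUnit N ≫ S := by simp [ι]
    rw [e4, mem_comprehension, ← Category.assoc, lift_fst, comp_chi_eq_tt_iff] at this
    exact this

instance : HasImages E where
  has_image := fun {I Z} h => by
    choose N n hn hl hm using exists_image h
    choose l hl using hl
    exact HasImage.mk
      { F := { I := N, m := n, e := l, fac := hl }
        isImage :=
          { lift := fun F' => Classical.choose (hm F'.I F'.m ⟨F'.e, F'.fac⟩)
            lift_fac := fun F' => Classical.choose_spec (hm F'.I F'.m ⟨F'.e, F'.fac⟩) } }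

/-- The truth value of `∃ i, h i = z`, as a predicate in `z`. -/
def inImage {I Z : E} (h : I ⟶ Z) : Z ⟶ Ω E := χ (image.ι h)

lemma self_comp_inImage {I Z T : E} (h : I ⟶ Z) (i : T ⟶ I) :
    (i ≫ h) ≫ inImage h = tt T :=
  (comp_chi_eq_tt_iff _ _).2 ⟨i ≫ factorThruImage h, by simp⟩

lemma inImage_elim {I Z W : E} (h : I ⟶ Z) (z : W ⟶ Z) (hz : z ≫ inImage h = tt W)
    (φ : W ⟶ Ω E)
    (H : ∀ (T : E) (t : T ⟶ W) (i : T ⟶ I), t ≫ z = i ≫ h → t ≫ φ = tt T) : φ = tt W := by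
  obtain ⟨N, n, hn, K⟩ := exists_forall z φ
  obtain ⟨l, hl⟩ := (K _ h).2 H
  obtain ⟨r, hr⟩ := (comp_chi_eq_tt_iff _ _).1 hz
  let F : MonoFactorisation h := { I := N, m := n, e := l, fac := hl }
  have := (K _ z).1 ⟨r ≫ image.lift F, by
    rw [Category.assoc]
    have : image.lift F ≫ n = image.ι h := image.lift_fac F
    rw [this, hr]⟩ W (𝟙 W) (𝟙 W) rfl
  simpa using this

end Logic

/-- The data of an internal quantale `(Q, ⊗, k, ⋁)` together with its order relation. -/
@[ext]
structure QuantaleData (E : Type u) [Category.{v} E] [ElementaryTopos E] where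
  /-- the underlying object -/
  carrier : E
  /-- the multiplication -/
  mul : carrier ⊗ carrier ⟶ carrier
  /-- the unit -/
  unit : 𝟙_ E ⟶ carrier
  /-- the order relation -/
  le : carrier ⊗ carrier ⟶ Ω E
  /-- the join operation on internal subsets -/
  sup : Pow carrier ⟶ carrier

namespace QuantaleData

variable {E : Type u} [Category.{v} E] [ElementaryTopos E] (Q : QuantaleData E)

/-- The product `x ⊗ y` of two generalized elements. -/
def m {X : E} (x y : X ⟶ Q.carrier) : X ⟶ Q.carrier := lift x y ≫ Q.mul

/-- The unit `k`, as a generalized element. -/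
def one (X : E) : X ⟶ Q.carrier := toUnit X ≫ Q.unit

/-- The relation `x ≤ y` holds for the generalized elements `x` and `y`. -/
def Le {X : E} (x y : X ⟶ Q.carrier) : Prop := lift x y ≫ Q.le = tt X

/-- The internal join `⋁ {q i | i ∈ I, f i = x}`, depending on `x ∈ X`: this is `⋁` applied to
`{c | ∃ i, q i = c ∧ f i = x}`. -/
def join {I X : E} (q : I ⟶ Q.carrier) (f : I ⟶ X) : X ⟶ Q.carrier :=
  comprehension (inImage (lift q f)) ≫ Q.sup

variable {Q}

/-- For a family `S` of internal subsets of `Q` indexed by `X`, the object `{(s, x) | s ∈ S x}`. -/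
def Elements {X : E} (S : X ⟶ Pow Q.carrier) : E :=
  equalizer (mem (fst Q.carrier X) (snd Q.carrier X ≫ S)) (tt _)

/-- The projection `(s, x) ↦ s`. -/
def elt {X : E} (S : X ⟶ Pow Q.carrier) : Elements S ⟶ Q.carrier := equalizer.ι _ _ ≫ fst _ _

/-- The projection `(s, x) ↦ x`. -/
def idx {X : E} (S : X ⟶ Pow Q.carrier) : Elements S ⟶ X := equalizer.ι _ _ ≫ snd _ _

variable (Q)

/-- `Q` is an internal quantale. All axioms are read in the internal language, by quantifying over
generalized elements at all stages. -/
class IsQuantale : Prop where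
  le_refl : ∀ {X : E} (x : X ⟶ Q.carrier), Q.Le x x
  le_trans : ∀ {X : E} (x y z : X ⟶ Q.carrier), Q.Le x y → Q.Le y z → Q.Le x z
  le_antisymm : ∀ {X : E} (x y : X ⟶ Q.carrier), Q.Le x y → Q.Le y x → x = y
  /-- `⋁ S ≤ z` if and only if `∀ s, s ∈ S → s ≤ z`. -/
  sup_le_iff : ∀ {X : E} (S : X ⟶ Pow Q.carrier) (z : X ⟶ Q.carrier),
    Q.Le (S ≫ Q.sup) z ↔ ∀ (Y : E) (f : Y ⟶ X) (s : Y ⟶ Q.carrier),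
      mem s (f ≫ S) = tt Y → Q.Le s (f ≫ z)
  mul_assoc : ∀ {X : E} (x y z : X ⟶ Q.carrier), Q.m (Q.m x y) z = Q.m x (Q.m y z)
  one_mul : ∀ {X : E} (x : X ⟶ Q.carrier), Q.m (Q.one X) x = x
  mul_one : ∀ {X : E} (x : X ⟶ Q.carrier), Q.m x (Q.one X) = x
  /-- `a ⊗ ⋁ S = ⋁ {a ⊗ s | s ∈ S}`. -/
  mul_sup : ∀ {X : E} (a : X ⟶ Q.carrier) (S : X ⟶ Pow Q.carrier),
    Q.m a (S ≫ Q.sup) = Q.join (Q.m (idx S ≫ a) (elt S)) (idx S)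
  /-- `⋁ S ⊗ a = ⋁ {s ⊗ a | s ∈ S}`. -/
  sup_mul : ∀ {X : E} (S : X ⟶ Pow Q.carrier) (a : X ⟶ Q.carrier),
    Q.m (S ≫ Q.sup) a = Q.join (Q.m (elt S) (idx S ≫ a)) (idx S)

/-- `Q` is an internal commutative quantale. -/
class IsCommQuantale : Prop extends Q.IsQuantale where
  mul_comm : ∀ {X : E} (x y : X ⟶ Q.carrier), Q.m x y = Q.m y x

variable {Q}

lemma comp_m {X Y : E} (f : Y ⟶ X) (x y : X ⟶ Q.carrier) :
    f ≫ Q.m x y = Q.m (f ≫ x) (f ≫ y) := by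
  simp [m, ← Category.assoc]

lemma comp_one {X Y : E} (f : Y ⟶ X) : f ≫ Q.one X = Q.one Y := by
  simp [one, ← Category.assoc]

lemma Le.comp {X Y : E} {x y : X ⟶ Q.carrier} (h : Q.Le x y) (f : Y ⟶ X) :
    Q.Le (f ≫ x) (f ≫ y) := by
  unfold Le at *
  rw [← comp_lift, Category.assoc, h, comp_tt]

lemma mem_elt {X : E} (S : X ⟶ Pow Q.carrier) : mem (elt S) (idx S ≫ S) = tt _ := by
  have := equalizer.condition (mem (fst Q.carrier X) (snd Q.carrier X ≫ S)) (tt _)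
  rw [comp_mem, comp_tt, ← Category.assoc] at this
  exact this

lemma exists_elements {X Y : E} {S : X ⟶ Pow Q.carrier} {s : Y ⟶ Q.carrier} {f : Y ⟶ X}
    (h : mem s (f ≫ S) = tt Y) : ∃ e : Y ⟶ Elements S, e ≫ elt S = s ∧ e ≫ idx S = f := by
  have h' : lift s f ≫ mem (fst Q.carrier X) (snd Q.carrier X ≫ S) = lift s f ≫ tt _ := by
    rw [comp_mem, comp_tt, ← Category.assoc, lift_fst, lift_snd, h]
  refine ⟨equalizer.lift (lift s f) h', ?_, ?_⟩
  · have := equalizer.lift_ι (lift s f) h' =≫ fst _ _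
    rw [Category.assoc, lift_fst] at this
    exact this
  · have := equalizer.lift_ι (lift s f) h' =≫ snd _ _
    rw [Category.assoc, lift_snd] at this
    exact this

variable [Q.IsCommQuantale]

lemma sup_le_iff' {X : E} (S : X ⟶ Pow Q.carrier) (z : X ⟶ Q.carrier) :
    Q.Le (S ≫ Q.sup) z ↔ ∀ (Y : E) (f : Y ⟶ X) (s : Y ⟶ Q.carrier),
      mem s (f ≫ S) = tt Y → Q.Le s (f ≫ z) := IsQuantale.sup_le_iff S z

lemma join_le_iff {I X Y : E} (q : I ⟶ Q.carrier) (f : I ⟶ X) (y : Y ⟶ X)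
    (z : Y ⟶ Q.carrier) :
    Q.Le (y ≫ Q.join q f) z ↔ ∀ (T : E) (t : T ⟶ Y) (i : T ⟶ I), i ≫ f = t ≫ y →
      Q.Le (i ≫ q) (t ≫ z) := by
  unfold join
  rw [← Category.assoc, sup_le_iff']
  constructor
  · intro h T t i hi
    refine h T t (i ≫ q) ?_
    rw [← Category.assoc, mem_comprehension, ← hi, ← comp_lift, self_comp_inImage]
  · intro h T t s hs
    rw [← Category.assoc, mem_comprehension] at hs
    refine inImage_elim _ _ hs _ fun T' t' i hi => ?_
    have h1 := congrArg (· ≫ fst _ _) hi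
    have h2 := congrArg (· ≫ snd _ _) hi
    simp at h1 h2
    have := h T' (t' ≫ t) i (by rw [← h2, Category.assoc])
    rw [← h1, Category.assoc] at this
    rw [← Category.assoc, comp_lift]
    exact this

lemma m_sup_le_iff {Y : E} (d : Y ⟶ Q.carrier) (S : Y ⟶ Pow Q.carrier) (z : Y ⟶ Q.carrier) :
    Q.Le (Q.m d (S ≫ Q.sup)) z ↔ ∀ (T : E) (t : T ⟶ Y) (s : T ⟶ Q.carrier),
      mem s (t ≫ S) = tt T → Q.Le (Q.m (t ≫ d) s) (t ≫ z) := by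
  have e1 : Q.m d (S ≫ Q.sup) = 𝟙 Y ≫ Q.join (Q.m (idx S ≫ d) (elt S)) (idx S) := by
    rw [Category.id_comp, ← IsQuantale.mul_sup]
  rw [e1, join_le_iff]
  constructor
  · intro h T t s hs
    obtain ⟨e, e2, e3⟩ := exists_elements hs
    have := h T t e (by simpa using e3)
    rwa [comp_m, ← Category.assoc, e2, e3] at this
  · intro h T t i hi
    rw [Category.comp_id] at hi
    subst hi
    rw [comp_m, ← Category.assoc]
    refine h T _ _ ?_
    rw [Category.assoc, ← comp_mem, mem_elt, comp_tt]

lemma m_join_le_iff {I X Y : E} (d : Y ⟶ Q.carrier) (q : I ⟶ Q.carrier) (f : I ⟶ X) (y : Y ⟶ X)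
    (z : Y ⟶ Q.carrier) :
    Q.Le (Q.m d (y ≫ Q.join q f)) z ↔ ∀ (T : E) (t : T ⟶ Y) (i : T ⟶ I), i ≫ f = t ≫ y →
      Q.Le (Q.m (t ≫ d) (i ≫ q)) (t ≫ z) := by
  unfold join
  rw [← Category.assoc, m_sup_le_iff]
  constructor
  · intro h T t i hi
    refine h T t (i ≫ q) ?_
    rw [← Category.assoc, mem_comprehension, ← hi, ← comp_lift, self_comp_inImage]
  · intro h T t s hs
    rw [← Category.assoc, mem_comprehension] at hs
    refine inImage_elim _ _ hs _ fun T' t' i hi => ?_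
    have h1 := congrArg (· ≫ fst _ _) hi
    have h2 := congrArg (· ≫ snd _ _) hi
    simp at h1 h2
    have := h T' (t' ≫ t) i (by rw [← h2, Category.assoc])
    rw [← h1, Category.assoc] at this
    rw [← Category.assoc, comp_lift, comp_m]
    simpa [Le] using this

instance {X : E} : Std.Associative (Q.m (X := X)) := ⟨IsQuantale.mul_assoc⟩
instance {X : E} : Std.Commutative (Q.m (X := X)) := ⟨IsCommQuantale.mul_comm⟩

lemma one_m {X : E} (x : X ⟶ Q.carrier) : Q.m (Q.one X) x = x := IsQuantale.one_mul x
lemma m_one {X : E} (x : X ⟶ Q.carrier) : Q.m x (Q.one X) = x := IsQuantale.mul_one x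
lemma m_comm {X : E} (x y : X ⟶ Q.carrier) : Q.m x y = Q.m y x := IsCommQuantale.mul_comm x y

lemma le_refl {X : E} (x : X ⟶ Q.carrier) : Q.Le x x := IsQuantale.le_refl x

lemma Le.trans {X : E} {x y z : X ⟶ Q.carrier} (h : Q.Le x y) (h' : Q.Le y z) : Q.Le x z :=
  IsQuantale.le_trans _ _ _ h h'

lemma Le.of_eq {X : E} {x y : X ⟶ Q.carrier} (h : x = y) : Q.Le x y := h ▸ le_refl x

lemma eq_of_le_iff {X : E} {x y : X ⟶ Q.carrier} (h : ∀ z, Q.Le x z ↔ Q.Le y z) : x = y :=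
  IsQuantale.le_antisymm _ _ ((h y).2 (le_refl y)) ((h x).1 (le_refl x))

lemma m_mono_right {X : E} (d : X ⟶ Q.carrier) {x y : X ⟶ Q.carrier} (h : Q.Le x y) :
    Q.Le (Q.m d x) (Q.m d y) := by
  let S : X ⟶ Pow Q.carrier := comprehension (lift (fst Q.carrier X) (snd Q.carrier X ≫ y) ≫ Q.le)
  have hS : ∀ {T : E} (t : T ⟶ X) (s : T ⟶ Q.carrier), mem s (t ≫ S) = tt T ↔ Q.Le s (t ≫ y) := by
    intro T t s
    rw [mem_comprehension, ← Category.assoc, comp_lift]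
    simp [Le]
  have hy : S ≫ Q.sup = y := by
    refine IsQuantale.le_antisymm _ _ ?_ ?_
    · exact (sup_le_iff' S y).2 fun T t s hs => (hS _ _).1 hs
    · have := (sup_le_iff' S _).1 (le_refl _) X (𝟙 X) y ((hS _ _).2 (by simpa using le_refl y))
      simpa using this
  have := (m_sup_le_iff d S _).1 (le_refl _) X (𝟙 X) x ((hS _ _).2 (by simpa using h))
  simpa [hy] using this

lemma m_mono {X : E} {x x' y y' : X ⟶ Q.carrier} (hx : Q.Le x x') (hy : Q.Le y y') :
    Q.Le (Q.m x y) (Q.m x' y') := by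
  refine (m_mono_right x hy).trans ?_
  rw [m_comm x, m_comm x']
  exact m_mono_right y' hx

end QuantaleData

section Relations

variable {E : Type u} [Category.{v} E] [ElementaryTopos E] {Q : QuantaleData E}

/-- The truth value `R(a, b)`. -/
def ap {A B X : E} (R : A ⊗ B ⟶ Q.carrier) (a : X ⟶ A) (b : X ⟶ B) : X ⟶ Q.carrier :=
  lift a b ≫ R

variable (Q) in
/-- The identity relation `1(a, a') = ⋁ {k | a = a'}`. -/
def idRel (A : E) : A ⊗ A ⟶ Q.carrier := Q.join (Q.one A) (lift (𝟙 A) (𝟙 A))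

variable (Q) in
/-- The graph of a morphism, `f(a, b) = ⋁ {k | f a = b}`. -/
def graphRel {A B : E} (f : A ⟶ B) : A ⊗ B ⟶ Q.carrier := Q.join (Q.one A) (lift (𝟙 A) f)

/-- The composite relation `(a, c) ↦ ⋁ {R(a, b) ⊗ S(b, c) | b ∈ B}`. -/
def compRel {A B C : E} (R : A ⊗ B ⟶ Q.carrier) (S : B ⊗ C ⟶ Q.carrier) : A ⊗ C ⟶ Q.carrier :=
  Q.join (I := A ⊗ (B ⊗ C))
    (Q.m (ap R (fst A (B ⊗ C)) (snd A (B ⊗ C) ≫ fst B C))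
      (ap S (snd A (B ⊗ C) ≫ fst B C) (snd A (B ⊗ C) ≫ snd B C)))
    (lift (fst A (B ⊗ C)) (snd A (B ⊗ C) ≫ snd B C))

/-- The tensor product of relations, `((a, a'), (b, b')) ↦ R(a, b) ⊗ R'(a', b')`. -/
def tensorRel {A B A' B' : E} (R : A ⊗ B ⟶ Q.carrier) (R' : A' ⊗ B' ⟶ Q.carrier) :
    (A ⊗ A') ⊗ (B ⊗ B') ⟶ Q.carrier :=
  Q.m (ap R (fst (A ⊗ A') (B ⊗ B') ≫ fst A A') (snd (A ⊗ A') (B ⊗ B') ≫ fst B B'))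
    (ap R' (fst (A ⊗ A') (B ⊗ B') ≫ snd A A') (snd (A ⊗ A') (B ⊗ B') ≫ snd B B'))

lemma comp_ap {A B X Y : E} (f : Y ⟶ X) (R : A ⊗ B ⟶ Q.carrier) (a : X ⟶ A) (b : X ⟶ B) :
    f ≫ ap R a b = ap R (f ≫ a) (f ≫ b) := by
  simp [ap, ← Category.assoc]

lemma ap_tensorRel {A B A' B' X : E} (R : A ⊗ B ⟶ Q.carrier) (R' : A' ⊗ B' ⟶ Q.carrier)
    (a : X ⟶ A ⊗ A') (b : X ⟶ B ⊗ B') :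
    ap (tensorRel R R') a b =
      Q.m (ap R (a ≫ fst _ _) (b ≫ fst _ _)) (ap R' (a ≫ snd _ _) (b ≫ snd _ _)) := by
  rw [ap, tensorRel, QuantaleData.comp_m, comp_ap, comp_ap]
  simp only [← Category.assoc, lift_fst, lift_snd]

lemma rel_ext {A B : E} {R S : A ⊗ B ⟶ Q.carrier}
    (h : ∀ (X : E) (a : X ⟶ A) (b : X ⟶ B), ap R a b = ap S a b) : R = S := by
  simpa [ap] using h _ (fst A B) (snd A B)

lemma idRel_eq_graphRel (A : E) : idRel Q A = graphRel Q (𝟙 A) := rfl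

open QuantaleData

variable [Q.IsCommQuantale]

lemma m_graphRel_le_iff {A B X : E} (f : A ⟶ B) (d : X ⟶ Q.carrier) (a : X ⟶ A) (b : X ⟶ B)
    (z : X ⟶ Q.carrier) :
    Q.Le (Q.m d (ap (graphRel Q f) a b)) z ↔ ∀ (T : E) (t : T ⟶ X), t ≫ a ≫ f = t ≫ b →
      Q.Le (t ≫ d) (t ≫ z) := by
  rw [ap, graphRel, m_join_le_iff]
  constructor
  · intro h T t ht
    have := h T t (t ≫ a) (by simp [comp_lift, ht])
    rwa [comp_one, m_one] at this
  · intro h T t i hi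
    have h1 := hi =≫ fst _ _
    have h2 := hi =≫ snd _ _
    simp at h1 h2
    rw [comp_one, m_one]
    exact h T t (by rw [← h2, h1, Category.assoc])

lemma m_compRel_le_iff {A B C X : E} (R : A ⊗ B ⟶ Q.carrier) (S : B ⊗ C ⟶ Q.carrier)
    (d : X ⟶ Q.carrier) (a : X ⟶ A) (c : X ⟶ C) (z : X ⟶ Q.carrier) :
    Q.Le (Q.m d (ap (compRel R S) a c)) z ↔ ∀ (T : E) (t : T ⟶ X) (b : T ⟶ B),
      Q.Le (Q.m (t ≫ d) (Q.m (ap R (t ≫ a) b) (ap S b (t ≫ c)))) (t ≫ z) := by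
  rw [ap, compRel, m_join_le_iff]
  constructor
  · intro h T t b
    have := h T t (lift (t ≫ a) (lift b (t ≫ c))) (by simp [comp_lift])
    rw [comp_m, comp_ap, comp_ap] at this
    simpa using this
  · intro h T t i hi
    have h1 := hi =≫ fst _ _
    have h2 := hi =≫ snd _ _
    simp at h1 h2
    rw [comp_m, comp_ap, comp_ap, h1, h2]
    exact h T t _

lemma compRel_le_iff {A B C X : E} (R : A ⊗ B ⟶ Q.carrier) (S : B ⊗ C ⟶ Q.carrier)
    (a : X ⟶ A) (c : X ⟶ C) (z : X ⟶ Q.carrier) :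
    Q.Le (ap (compRel R S) a c) z ↔ ∀ (T : E) (t : T ⟶ X) (b : T ⟶ B),
      Q.Le (Q.m (ap R (t ≫ a) b) (ap S b (t ≫ c))) (t ≫ z) := by
  have := m_compRel_le_iff R S (Q.one X) a c z
  simpa only [one_m, comp_one] using this

lemma graphRel_le_iff {A B X : E} (f : A ⟶ B) (a : X ⟶ A) (b : X ⟶ B) (z : X ⟶ Q.carrier) :
    Q.Le (ap (graphRel Q f) a b) z ↔ ∀ (T : E) (t : T ⟶ X), t ≫ a ≫ f = t ≫ b →
      Q.Le (Q.one T) (t ≫ z) := by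
  have := m_graphRel_le_iff f (Q.one X) a b z
  simpa only [one_m, comp_one] using this

lemma graphRel_compRel {A B C : E} (f : A ⟶ B) (R : B ⊗ C ⟶ Q.carrier) :
    compRel (graphRel Q f) R = (f ▷ C) ≫ R := by
  refine rel_ext fun X a c => eq_of_le_iff fun z => ?_
  have e : ap ((f ▷ C) ≫ R) a c = ap R (a ≫ f) c := by
    rw [ap, ← Category.assoc, lift_whiskerRight]; rfl
  rw [compRel_le_iff, e]
  constructor
  · intro h
    have := h X (𝟙 X) (a ≫ f)
    rw [m_comm, m_graphRel_le_iff] at this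
    simpa using this X (𝟙 X) (by simp)
  · intro h T t b
    rw [m_comm, m_graphRel_le_iff]
    intro T' t' ht'
    have := h.comp (t' ≫ t)
    rw [comp_ap] at this ⊢
    simp only [Category.assoc] at this ht' ⊢
    rwa [ht'] at this

/-- Postcomposition with the graph of an isomorphism. -/
lemma compRel_graphRel {A B C : E} (R : A ⊗ B ⟶ Q.carrier) (f : B ≅ C) :
    compRel R (graphRel Q f.hom) = (A ◁ f.inv) ≫ R := by
  refine rel_ext fun X a c => eq_of_le_iff fun z => ?_
  have e : ap ((A ◁ f.inv) ≫ R) a c = ap R a (c ≫ f.inv) := by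
    rw [ap, ← Category.assoc, lift_whiskerLeft]; rfl
  rw [compRel_le_iff, e]
  constructor
  · intro h
    have := h X (𝟙 X) (c ≫ f.inv)
    rw [m_graphRel_le_iff] at this
    simpa using this X (𝟙 X) (by simp)
  · intro h T t b
    rw [m_graphRel_le_iff]
    intro T' t' ht'
    have := h.comp (t' ≫ t)
    rw [comp_ap] at this ⊢
    rw [← Category.assoc, ← Iso.eq_comp_inv] at ht'
    simpa [ht'] using this

lemma id_compRel {A B : E} (R : A ⊗ B ⟶ Q.carrier) : compRel (idRel Q A) R = R := by
  rw [idRel_eq_graphRel, graphRel_compRel]; simp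

lemma compRel_id {A B : E} (R : A ⊗ B ⟶ Q.carrier) : compRel R (idRel Q B) = R := by
  have := compRel_graphRel R (Iso.refl B)
  simpa [idRel_eq_graphRel] using this

lemma compRel_assoc {A B C D : E} (R : A ⊗ B ⟶ Q.carrier) (S : B ⊗ C ⟶ Q.carrier)
    (T : C ⊗ D ⟶ Q.carrier) : compRel (compRel R S) T = compRel R (compRel S T) := by
  refine rel_ext fun X a d => eq_of_le_iff fun z => ?_
  rw [compRel_le_iff, compRel_le_iff]
  constructor
  · intro h T₁ t₁ b
    rw [m_compRel_le_iff]
    intro T₂ t₂ c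
    have := h T₂ (t₂ ≫ t₁) c
    rw [m_comm, m_compRel_le_iff] at this
    have := this T₂ (𝟙 _) (t₂ ≫ b)
    simp only [Category.id_comp, Category.assoc] at this
    rw [comp_ap]
    refine (Le.of_eq ?_).trans this
    ac_rfl
  · intro h T₁ t₁ c
    rw [m_comm, m_compRel_le_iff]
    intro T₂ t₂ b
    have := h T₂ (t₂ ≫ t₁) b
    rw [m_compRel_le_iff] at this
    have := this T₂ (𝟙 _) (t₂ ≫ c)
    simp only [Category.id_comp, Category.assoc] at this
    rw [comp_ap]
    refine (Le.of_eq ?_).trans this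
    ac_rfl

lemma graphRel_comp {A B C : E} (f : A ⟶ B) (g : B ⟶ C) :
    compRel (graphRel Q f) (graphRel Q g) = graphRel Q (f ≫ g) := by
  rw [graphRel_compRel]
  refine rel_ext fun X a c => eq_of_le_iff fun z => ?_
  have e : ap ((f ▷ C) ≫ graphRel Q g) a c = ap (graphRel Q g) (a ≫ f) c := by
    rw [ap, ← Category.assoc, lift_whiskerRight]; rfl
  rw [e, graphRel_le_iff, graphRel_le_iff]
  simp

lemma tensorRel_graphRel {A B A' B' : E} (f : A ⟶ B) (g : A' ⟶ B') :
    tensorRel (graphRel Q f) (graphRel Q g) = graphRel Q (f ⊗ₘ g) := by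
  refine rel_ext fun X a b => eq_of_le_iff fun z => ?_
  rw [ap_tensorRel, m_graphRel_le_iff, graphRel_le_iff]
  constructor
  · intro h T t ht
    have h1 := ht =≫ fst _ _
    have h2 := ht =≫ snd _ _
    simp at h1 h2
    have := h T t (by simpa using h2)
    rw [comp_ap, graphRel_le_iff] at this
    simpa using this T (𝟙 T) (by simpa using h1)
  · intro h T t ht
    rw [comp_ap, graphRel_le_iff]
    intro T' t' ht'
    have := h T' (t' ≫ t) (by
      ext
      · simpa using ht'
      · simpa using t' ≫= ht)
    simpa using this

lemma tensorRel_compRel {A B C A' B' C' : E} (R : A ⊗ B ⟶ Q.carrier) (S : B ⊗ C ⟶ Q.carrier)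
    (R' : A' ⊗ B' ⟶ Q.carrier) (S' : B' ⊗ C' ⟶ Q.carrier) :
    compRel (tensorRel R R') (tensorRel S S') = tensorRel (compRel R S) (compRel R' S') := by
  refine rel_ext fun X a c => eq_of_le_iff fun z => ?_
  rw [ap_tensorRel, compRel_le_iff, m_compRel_le_iff]
  constructor
  · intro h T₁ t₁ b'
    rw [comp_ap, m_comm, m_compRel_le_iff]
    intro T₂ t₂ b
    have := h T₂ (t₂ ≫ t₁) (lift b (t₂ ≫ b'))
    simp only [ap_tensorRel, comp_m, comp_ap, lift_fst, lift_snd, Category.assoc] at this ⊢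
    refine (Le.of_eq ?_).trans this
    ac_rfl
  · intro h T₁ t₁ b
    have := h T₁ t₁ (b ≫ snd _ _)
    rw [comp_ap, m_comm, m_compRel_le_iff] at this
    have := this T₁ (𝟙 _) (b ≫ fst _ _)
    simp only [ap_tensorRel, Category.id_comp, Category.assoc] at this ⊢
    refine (Le.of_eq ?_).trans this
    ac_rfl

end Relations

/-- Terms over the operation symbols `Op` with arities `ar`, in `n` variables. -/
inductive Term {Op : Type w} (ar : Op → ℕ) (n : ℕ) : Type w
  | var (i : Fin n) : Term ar n
  | app (σ : Op) (args : Fin (ar σ) → Term ar n) : Term ar n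

/-- An algebraic signature `(Σ, E)`: operation symbols of finite arity, and a set of equations
between terms, each in finitely many variables. -/
structure Signature where
  /-- the operation symbols -/
  Op : Type w
  /-- the arities -/
  arity : Op → ℕ
  /-- the equations -/
  eqs : ∀ n : ℕ, Set (Term arity n × Term arity n)

section Algebras

variable (S : Signature.{w}) {E : Type u} [Category.{v} E] [ElementaryTopos E]

/-- The value of a term at the generalized elements `ρ`, for operations `op` on `A`. -/
def Term.eval {S : Signature.{w}} {A : E} (op : ∀ σ : S.Op, (∏ᶜ fun _ : Fin (S.arity σ) => A) ⟶ A)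
    {n : ℕ} {X : E} (ρ : Fin n → (X ⟶ A)) : Term S.arity n → (X ⟶ A)
  | .var i => ρ i
  | .app σ args => Pi.lift (fun i => (args i).eval op ρ) ≫ op σ

variable (E) in
/-- A `(Σ, E)`-algebra in the topos `E`. -/
@[ext]
structure Algebra where
  /-- the underlying object -/
  carrier : E
  /-- the operations -/
  op : ∀ σ : S.Op, (∏ᶜ fun _ : Fin (S.arity σ) => carrier) ⟶ carrier
  /-- the equations hold, as equations between morphisms out of a power of the carrier -/
  eqs : ∀ (n : ℕ) (e : Term S.arity n × Term S.arity n), e ∈ S.eqs n →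
    e.1.eval op (fun i => Pi.π (fun _ : Fin n => carrier) i) =
      e.2.eval op (fun i => Pi.π (fun _ : Fin n => carrier) i)

variable {S}

lemma Term.comp_eval {A : E} (op : ∀ σ : S.Op, (∏ᶜ fun _ : Fin (S.arity σ) => A) ⟶ A)
    {n : ℕ} {X Y : E} (f : Y ⟶ X) (ρ : Fin n → (X ⟶ A)) (t : Term S.arity n) :
    f ≫ t.eval op ρ = t.eval op (fun i => f ≫ ρ i) := by
  induction t with
  | var i => rfl
  | app σ args ih =>
    simp only [Term.eval]
    rw [← Category.assoc]
    congr 1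
    ext i
    simp [ih]

/-- `f` is a homomorphism of algebras. -/
def Algebra.IsHom (A B : Algebra S E) (f : A.carrier ⟶ B.carrier) : Prop :=
  ∀ (σ : S.Op) (X : E) (a : Fin (S.arity σ) → (X ⟶ A.carrier)),
    Pi.lift a ≫ A.op σ ≫ f = Pi.lift (fun i => a i ≫ f) ≫ B.op σ

lemma Term.eval_hom {A B : E} {opA : ∀ σ : S.Op, (∏ᶜ fun _ : Fin (S.arity σ) => A) ⟶ A}
    {opB : ∀ σ : S.Op, (∏ᶜ fun _ : Fin (S.arity σ) => B) ⟶ B} (f : A ⟶ B)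
    (hf : ∀ (σ : S.Op) (X : E) (a : Fin (S.arity σ) → (X ⟶ A)),
      Pi.lift a ≫ opA σ ≫ f = Pi.lift (fun i => a i ≫ f) ≫ opB σ)
    {n : ℕ} {X : E} (ρ : Fin n → (X ⟶ A)) (t : Term S.arity n) :
    t.eval opA ρ ≫ f = t.eval opB (fun i => ρ i ≫ f) := by
  induction t with
  | var i => rfl
  | app σ args ih =>
    simp only [Term.eval, Category.assoc, hf, ih]

lemma Algebra.eval_eq (A : Algebra S E) {n : ℕ} {e : Term S.arity n × Term S.arity n}
    (he : e ∈ S.eqs n) {X : E} (ρ : Fin n → (X ⟶ A.carrier)) :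
    e.1.eval A.op ρ = e.2.eval A.op ρ := by
  have := Pi.lift ρ ≫= A.eqs n e he
  simpa [Term.comp_eval] using this

variable (S E) in
/-- The terminal algebra. -/
abbrev Algebra.unit : Algebra S E where
  carrier := 𝟙_ E
  op _ := toUnit _
  eqs _ _ _ := Subsingleton.elim _ _

/-- The product of two algebras. -/
abbrev Algebra.prod (A B : Algebra S E) : Algebra S E where
  carrier := A.carrier ⊗ B.carrier
  op σ := lift
    (Pi.lift (fun i => Pi.π (fun _ : Fin (S.arity σ) => A.carrier ⊗ B.carrier) i ≫ fst _ _) ≫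
      A.op σ)
    (Pi.lift (fun i => Pi.π (fun _ : Fin (S.arity σ) => A.carrier ⊗ B.carrier) i ≫ snd _ _) ≫
      B.op σ)
  eqs n e he := by
    have h1 := fun t : Term S.arity n => Term.eval_hom
      (opA := fun σ => lift
        (Pi.lift (fun i => Pi.π (fun _ : Fin (S.arity σ) => A.carrier ⊗ B.carrier) i ≫ fst _ _) ≫
          A.op σ)
        (Pi.lift (fun i => Pi.π (fun _ : Fin (S.arity σ) => A.carrier ⊗ B.carrier) i ≫ snd _ _) ≫
          B.op σ)) (opB := A.op) (fst A.carrier B.carrier)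
      (fun σ X a => by
        rw [lift_fst, ← Category.assoc]
        congr 1
        ext i
        simp) (fun i => Pi.π (fun _ : Fin n => A.carrier ⊗ B.carrier) i) t
    have h2 := fun t : Term S.arity n => Term.eval_hom
      (opA := fun σ => lift
        (Pi.lift (fun i => Pi.π (fun _ : Fin (S.arity σ) => A.carrier ⊗ B.carrier) i ≫ fst _ _) ≫
          A.op σ)
        (Pi.lift (fun i => Pi.π (fun _ : Fin (S.arity σ) => A.carrier ⊗ B.carrier) i ≫ snd _ _) ≫
          B.op σ)) (opB := B.op) (snd A.carrier B.carrier)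
      (fun σ X a => by
        rw [lift_snd, ← Category.assoc]
        congr 1
        ext i
        simp) (fun i => Pi.π (fun _ : Fin n => A.carrier ⊗ B.carrier) i) t
    ext
    · rw [h1, h1, A.eval_eq he]
    · rw [h2, h2, B.eval_eq he]

lemma Algebra.lift_prod_op_fst (A B : Algebra S E) (σ : S.Op) {X : E}
    (a : Fin (S.arity σ) → (X ⟶ (A.prod B).carrier)) :
    Pi.lift a ≫ (A.prod B).op σ ≫ fst A.carrier B.carrier =
      Pi.lift (fun i => a i ≫ fst A.carrier B.carrier) ≫ A.op σ := by
  simp only [Algebra.prod, lift_fst, ← Category.assoc]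
  congr 1
  ext i
  simp

lemma Algebra.lift_prod_op_snd (A B : Algebra S E) (σ : S.Op) {X : E}
    (a : Fin (S.arity σ) → (X ⟶ (A.prod B).carrier)) :
    Pi.lift a ≫ (A.prod B).op σ ≫ snd A.carrier B.carrier =
      Pi.lift (fun i => a i ≫ snd A.carrier B.carrier) ≫ B.op σ := by
  simp only [Algebra.prod, lift_snd, ← Category.assoc]
  congr 1
  ext i
  simp

lemma Algebra.isHom_id (A : Algebra S E) : A.IsHom A (𝟙 A.carrier) := by
  intro σ X a; simp

lemma Algebra.IsHom.comp {A B C : Algebra S E} {f : A.carrier ⟶ B.carrier}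
    {g : B.carrier ⟶ C.carrier} (hf : A.IsHom B f) (hg : B.IsHom C g) : A.IsHom C (f ≫ g) := by
  intro σ X a
  have h1 := hf σ X a =≫ g
  simp only [Category.assoc] at h1
  rw [h1, hg σ X]
  simp

lemma Algebra.isHom_fst (A B : Algebra S E) : (A.prod B).IsHom A (fst A.carrier B.carrier) :=
  fun σ _ a => A.lift_prod_op_fst B σ a

lemma Algebra.isHom_snd (A B : Algebra S E) : (A.prod B).IsHom B (snd A.carrier B.carrier) :=
  fun σ _ a => A.lift_prod_op_snd B σ a

lemma Algebra.isHom_toUnit (A : Algebra S E) : A.IsHom (Algebra.unit S E) (toUnit A.carrier) :=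
  fun _ _ _ => Subsingleton.elim (α := _ ⟶ 𝟙_ E) _ _

lemma Algebra.IsHom.lift {A B C : Algebra S E} {f : A.carrier ⟶ B.carrier}
    {g : A.carrier ⟶ C.carrier} (hf : A.IsHom B f) (hg : A.IsHom C g) :
    A.IsHom (B.prod C) (CartesianMonoidalCategory.lift f g) := by
  intro σ X a
  refine CartesianMonoidalCategory.hom_ext (X := B.carrier) (Y := C.carrier) _ _ ?_ ?_
  · rw [Category.assoc, Category.assoc, Category.assoc, lift_fst, lift_prod_op_fst, hf σ X]
    simp
  · rw [Category.assoc, Category.assoc, Category.assoc, lift_snd, lift_prod_op_snd, hg σ X]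
    simp

end Algebras

section AlgebraicRelations

variable {S : Signature.{w}} {E : Type u} [Category.{v} E] [ElementaryTopos E]

/-- The product `x₀ ⊗ ⋯ ⊗ xₙ₋₁`, which is the unit for `n = 0`. -/
def QuantaleData.prod (Q : QuantaleData E) {X : E} :
    ∀ {n : ℕ}, (Fin n → (X ⟶ Q.carrier)) → (X ⟶ Q.carrier)
  | 0, _ => Q.one X
  | _ + 1, x => Q.m (x 0) (Q.prod (fun i => x i.succ))

variable {Q : QuantaleData E}

/-- The relation `R` between algebras is algebraic: for each operation symbol `σ`,
`R(a₁, b₁) ⊗ ⋯ ⊗ R(aₙ, bₙ) ≤ R(σ(a₁, …, aₙ), σ(b₁, …, bₙ))`. -/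
def IsAlgebraic (A B : Algebra S E) (R : A.carrier ⊗ B.carrier ⟶ Q.carrier) : Prop :=
  ∀ (σ : S.Op) (X : E) (a : Fin (S.arity σ) → (X ⟶ A.carrier))
    (b : Fin (S.arity σ) → (X ⟶ B.carrier)),
    Q.Le (Q.prod fun i => ap R (a i) (b i)) (ap R (Pi.lift a ≫ A.op σ) (Pi.lift b ≫ B.op σ))

open QuantaleData

lemma comp_prod {X Y : E} (f : Y ⟶ X) {n : ℕ} (x : Fin n → (X ⟶ Q.carrier)) :
    f ≫ Q.prod x = Q.prod fun i => f ≫ x i := by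
  induction n with
  | zero => exact comp_one f
  | succ n ih => rw [QuantaleData.prod, comp_m, ih]; rfl

variable [Q.IsCommQuantale]


lemma m_prod_graphRel_le {A B X : E} (f : A ⟶ B) {n : ℕ} (a : Fin n → (X ⟶ A))
    (b : Fin n → (X ⟶ B)) (d z : X ⟶ Q.carrier)
    (h : ∀ (T : E) (t : T ⟶ X), (∀ i, t ≫ a i ≫ f = t ≫ b i) → Q.Le (t ≫ d) (t ≫ z)) :
    Q.Le (Q.m d (Q.prod fun i => ap (graphRel Q f) (a i) (b i))) z := by
  induction n generalizing X with
  | zero =>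
    rw [QuantaleData.prod, m_one]
    simpa using h X (𝟙 X) (fun i => i.elim0)
  | succ n ih =>
    rw [QuantaleData.prod, m_comm (ap _ _ _), ← IsQuantale.mul_assoc, m_graphRel_le_iff]
    intro T t ht
    rw [comp_m, comp_prod]
    simp only [comp_ap]
    refine ih _ _ _ _ fun T' t' ht' => ?_
    have := h T' (t' ≫ t) (fun i => by
      refine Fin.cases ?_ (fun j => ?_) i
      · simpa using t' ≫= ht
      · simpa using ht' j)
    simpa using this

lemma m_prod_compRel_le {A B C X : E} (R : A ⊗ B ⟶ Q.carrier) (R' : B ⊗ C ⟶ Q.carrier) {n : ℕ}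
    (a : Fin n → (X ⟶ A)) (c : Fin n → (X ⟶ C)) (d z : X ⟶ Q.carrier)
    (h : ∀ (T : E) (t : T ⟶ X) (b : Fin n → (T ⟶ B)),
      Q.Le (Q.m (t ≫ d) (Q.m (Q.prod fun i => ap R (t ≫ a i) (b i))
        (Q.prod fun i => ap R' (b i) (t ≫ c i)))) (t ≫ z)) :
    Q.Le (Q.m d (Q.prod fun i => ap (compRel R R') (a i) (c i))) z := by
  induction n generalizing X with
  | zero =>
    have := h X (𝟙 X) (fun i => i.elim0)
    simp only [QuantaleData.prod, m_one, Category.id_comp] at this ⊢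
    exact this
  | succ n ih =>
    rw [QuantaleData.prod, m_comm (ap _ _ _), ← IsQuantale.mul_assoc, m_compRel_le_iff]
    intro T t b₀
    rw [comp_m, comp_prod]
    simp only [comp_ap]
    have e : ∀ p q r : T ⟶ Q.carrier, Q.m (Q.m p q) r = Q.m (Q.m p r) q := by
      intro p q r; ac_rfl
    rw [e]
    refine ih _ _ _ _ fun T' t' b => ?_
    have := h T' (t' ≫ t) (Fin.cons (t' ≫ b₀) b)
    simp only [QuantaleData.prod, Fin.cons_zero, Fin.cons_succ, comp_m, comp_ap,
      Category.assoc] at this ⊢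
    refine (Le.of_eq ?_).trans this
    ac_rfl

lemma prod_m {X : E} {n : ℕ} (x y : Fin n → (X ⟶ Q.carrier)) :
    Q.prod (fun i => Q.m (x i) (y i)) = Q.m (Q.prod x) (Q.prod y) := by
  induction n with
  | zero => simp only [QuantaleData.prod, m_one]
  | succ n ih =>
    simp only [QuantaleData.prod, ih]
    ac_rfl

lemma IsAlgebraic.graph {A B : Algebra S E} {f : A.carrier ⟶ B.carrier} (hf : A.IsHom B f) :
    IsAlgebraic A B (graphRel Q f) := by
  intro σ X a b
  have := m_prod_graphRel_le (Q := Q) f a b (Q.one X)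
    (ap (graphRel Q f) (Pi.lift a ≫ A.op σ) (Pi.lift b ≫ B.op σ)) (fun T t ht => by
      have h1 := (graphRel_le_iff (Q := Q) f (t ≫ Pi.lift a ≫ A.op σ) (t ≫ Pi.lift b ≫ B.op σ) _).1
        (le_refl _) T (𝟙 T) (by
          rw [Category.assoc, Category.assoc, hf σ X]
          simp only [← Category.assoc]
          congr 1
          ext i
          simpa using ht i)
      rw [comp_one, comp_ap]
      simpa using h1)
  rwa [one_m] at this

lemma IsAlgebraic.id (A : Algebra S E) : IsAlgebraic A A (idRel Q A.carrier) :=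
  IsAlgebraic.graph A.isHom_id

lemma IsAlgebraic.comp {A B C : Algebra S E} {R : A.carrier ⊗ B.carrier ⟶ Q.carrier}
    {R' : B.carrier ⊗ C.carrier ⟶ Q.carrier} (h : IsAlgebraic A B R) (h' : IsAlgebraic B C R') :
    IsAlgebraic A C (compRel R R') := by
  intro σ X a c
  have := m_prod_compRel_le R R' a c (Q.one X)
    (ap (compRel R R') (Pi.lift a ≫ A.op σ) (Pi.lift c ≫ C.op σ)) (fun T t b => by
      have h1 := (compRel_le_iff R R' (t ≫ Pi.lift a ≫ A.op σ) (t ≫ Pi.lift c ≫ C.op σ) _).1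
        (le_refl _) T (𝟙 T) (Pi.lift b ≫ B.op σ)
      rw [comp_one, one_m, comp_ap]
      simp only [Category.id_comp] at h1
      refine (m_mono (h σ T (fun i => t ≫ a i) b) (h' σ T b (fun i => t ≫ c i))).trans ?_
      refine (Le.of_eq ?_).trans h1
      have e : ∀ {Z : E} {n : ℕ} (x : Fin n → (X ⟶ Z)),
          t ≫ Pi.lift x = Pi.lift (fun i => t ≫ x i) := by
        intro Z n x; ext i; simp
      rw [← Category.assoc, ← Category.assoc t, e, e])
  rwa [one_m] at this

lemma IsAlgebraic.tensor {A B A' B' : Algebra S E} {R : A.carrier ⊗ B.carrier ⟶ Q.carrier}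
    {R' : A'.carrier ⊗ B'.carrier ⟶ Q.carrier} (h : IsAlgebraic A B R) (h' : IsAlgebraic A' B' R') :
    IsAlgebraic (A.prod A') (B.prod B') (tensorRel R R') := by
  intro σ X a b
  rw [ap_tensorRel,
    (Category.assoc _ _ _).trans (A.lift_prod_op_fst A' σ a),
    (Category.assoc _ _ _).trans (A.lift_prod_op_snd A' σ a),
    (Category.assoc _ _ _).trans (B.lift_prod_op_fst B' σ b),
    (Category.assoc _ _ _).trans (B.lift_prod_op_snd B' σ b)]
  simp only [ap_tensorRel, prod_m]
  exact m_mono (h σ X _ _) (h' σ X _ _)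

end AlgebraicRelations

section Coherence

variable {E : Type u} [Category.{v} E] [ElementaryTopos E] {Q : QuantaleData E}
  [Q.IsCommQuantale]

open QuantaleData

/-- The exchange of factors. -/
@[simps]
def swapIso (A B : E) : A ⊗ B ≅ B ⊗ A where
  hom := lift (snd A B) (fst A B)
  inv := lift (snd B A) (fst B A)

lemma tensorRel_id (A B : E) : tensorRel (idRel Q A) (idRel Q B) = idRel Q (A ⊗ B) := by
  simp only [idRel_eq_graphRel]
  rw [tensorRel_graphRel, id_tensorHom_id]

lemma ap_whiskerRight {A B C X : E} (f : A ⟶ B) (R : B ⊗ C ⟶ Q.carrier) (a : X ⟶ A)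
    (c : X ⟶ C) : ap ((f ▷ C) ≫ R) a c = ap R (a ≫ f) c := by
  rw [ap, ← Category.assoc, lift_whiskerRight]; rfl

lemma ap_whiskerLeft {A B C X : E} (f : B ⟶ C) (R : A ⊗ C ⟶ Q.carrier) (a : X ⟶ A)
    (b : X ⟶ B) : ap ((A ◁ f) ≫ R) a b = ap R a (b ≫ f) := by
  rw [ap, ← Category.assoc, lift_whiskerLeft]; rfl

lemma ap_idRel_unit {X : E} (a b : X ⟶ 𝟙_ E) : ap (idRel Q (𝟙_ E)) a b = Q.one X := by
  refine eq_of_le_iff fun z => ?_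
  rw [idRel_eq_graphRel, graphRel_le_iff]
  constructor
  · intro h
    simpa using h X (𝟙 X) (Subsingleton.elim _ _)
  · intro h T t _
    have := h.comp t
    rwa [comp_one] at this

lemma associatorRel_naturality {A₁ A₂ A₃ B₁ B₂ B₃ : E} (R₁ : A₁ ⊗ B₁ ⟶ Q.carrier)
    (R₂ : A₂ ⊗ B₂ ⟶ Q.carrier) (R₃ : A₃ ⊗ B₃ ⟶ Q.carrier) :
    compRel (tensorRel (tensorRel R₁ R₂) R₃) (graphRel Q (α_ B₁ B₂ B₃).hom) =
      compRel (graphRel Q (α_ A₁ A₂ A₃).hom) (tensorRel R₁ (tensorRel R₂ R₃)) := by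
  rw [graphRel_compRel, compRel_graphRel]
  refine rel_ext fun X a b => ?_
  simp only [ap_whiskerLeft, ap_whiskerRight, ap_tensorRel, Category.assoc, associator_inv_fst_fst,
    associator_inv_fst_snd, associator_inv_snd, associator_hom_fst, associator_hom_snd_fst,
    associator_hom_snd_snd]
  ac_rfl

lemma leftUnitorRel_naturality {A B : E} (R : A ⊗ B ⟶ Q.carrier) :
    compRel (tensorRel (idRel Q (𝟙_ E)) R) (graphRel Q (λ_ B).hom) =
      compRel (graphRel Q (λ_ A).hom) R := by
  rw [graphRel_compRel, compRel_graphRel]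
  refine rel_ext fun X a b => ?_
  simp only [ap_whiskerLeft, ap_whiskerRight, ap_tensorRel, ap_idRel_unit, one_m, Category.assoc,
    leftUnitor_inv_snd, leftUnitor_hom, Category.comp_id]

lemma rightUnitorRel_naturality {A B : E} (R : A ⊗ B ⟶ Q.carrier) :
    compRel (tensorRel R (idRel Q (𝟙_ E))) (graphRel Q (ρ_ B).hom) =
      compRel (graphRel Q (ρ_ A).hom) R := by
  rw [graphRel_compRel, compRel_graphRel]
  refine rel_ext fun X a b => ?_
  simp only [ap_whiskerLeft, ap_whiskerRight, ap_tensorRel, ap_idRel_unit, m_one, Category.assoc,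
    rightUnitor_inv_fst, rightUnitor_hom, Category.comp_id]

lemma swapRel_naturality {A A' B B' : E} (R : A ⊗ B ⟶ Q.carrier) (R' : A' ⊗ B' ⟶ Q.carrier) :
    compRel (tensorRel R R') (graphRel Q (swapIso B B').hom) =
      compRel (graphRel Q (swapIso A A').hom) (tensorRel R' R) := by
  rw [graphRel_compRel, compRel_graphRel]
  refine rel_ext fun X a b => ?_
  simp only [ap_whiskerLeft, ap_whiskerRight, ap_tensorRel, Category.assoc, swapIso_hom,
    swapIso_inv, lift_fst, lift_snd]
  ac_rfl

lemma pentagonRel (A B C D : E) :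
    compRel (tensorRel (graphRel Q (α_ A B C).hom) (idRel Q D))
      (compRel (graphRel Q (α_ A (B ⊗ C) D).hom)
        (tensorRel (idRel Q A) (graphRel Q (α_ B C D).hom))) =
      compRel (graphRel Q (α_ (A ⊗ B) C D).hom) (graphRel Q (α_ A B (C ⊗ D)).hom) := by
  simp only [idRel_eq_graphRel, tensorRel_graphRel, graphRel_comp, tensorHom_id, id_tensorHom,
    MonoidalCategory.pentagon]

lemma triangleRel (A B : E) :
    compRel (graphRel Q (α_ A (𝟙_ E) B).hom) (tensorRel (idRel Q A) (graphRel Q (λ_ B).hom)) =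
      tensorRel (graphRel Q (ρ_ A).hom) (idRel Q B) := by
  simp only [idRel_eq_graphRel, tensorRel_graphRel, graphRel_comp, tensorHom_id, id_tensorHom,
    MonoidalCategory.triangle]

lemma hexagonRel_forward (A B C : E) :
    compRel (graphRel Q (α_ A B C).hom) (compRel (graphRel Q (swapIso A (B ⊗ C)).hom)
      (graphRel Q (α_ B C A).hom)) =
    compRel (tensorRel (graphRel Q (swapIso A B).hom) (idRel Q C))
      (compRel (graphRel Q (α_ B A C).hom)
        (tensorRel (idRel Q B) (graphRel Q (swapIso A C).hom))) := by
  simp only [idRel_eq_graphRel, tensorRel_graphRel, graphRel_comp]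
  congr 1
  ext <;> simp

lemma hexagonRel_reverse (A B C : E) :
    compRel (graphRel Q (α_ A B C).inv) (compRel (graphRel Q (swapIso (A ⊗ B) C).hom)
      (graphRel Q (α_ C A B).inv)) =
    compRel (tensorRel (idRel Q A) (graphRel Q (swapIso B C).hom))
      (compRel (graphRel Q (α_ A C B).inv)
        (tensorRel (graphRel Q (swapIso A C).hom) (idRel Q B))) := by
  simp only [idRel_eq_graphRel, tensorRel_graphRel, graphRel_comp]
  congr 1
  ext <;> simp

lemma swapRel_symmetry (A B : E) :
    compRel (graphRel Q (swapIso A B).hom) (graphRel Q (swapIso B A).hom) =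
      idRel Q (A ⊗ B) := by
  rw [idRel_eq_graphRel, graphRel_comp]
  congr 1
  ext <;> simp

end Coherence

section RelCategory

variable (S : Signature.{w}) {E : Type u} [Category.{v} E] [ElementaryTopos E]
  (Q : QuantaleData E)

/-- The objects of the category of algebraic `Q`-relations: `(Σ, E)`-algebras. -/
@[ext]
structure Rel (S : Signature.{w}) {E : Type u} [Category.{v} E] [ElementaryTopos E]
    (Q : QuantaleData E) where
  /-- the underlying algebra -/
  alg : Algebra S E

variable {S Q}

/-- The morphisms of the category of algebraic `Q`-relations. -/
@[ext]
structure Rel.Hom (A B : Rel S Q) where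
  /-- the underlying `Q`-relation -/
  rel : A.alg.carrier ⊗ B.alg.carrier ⟶ Q.carrier
  /-- the relation is algebraic -/
  algebraic : IsAlgebraic A.alg B.alg rel

variable [Q.IsCommQuantale]

namespace Rel

instance : Category (Rel S Q) where
  Hom := Rel.Hom
  id A := ⟨idRel Q A.alg.carrier, IsAlgebraic.id A.alg⟩
  comp R R' := ⟨compRel R.rel R'.rel, R.algebraic.comp R'.algebraic⟩
  id_comp R := Rel.Hom.ext (id_compRel R.rel)
  comp_id R := Rel.Hom.ext (compRel_id R.rel)
  assoc R R' R'' := Rel.Hom.ext (compRel_assoc R.rel R'.rel R''.rel)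

/-- The underlying `Q`-relation of a morphism. -/
abbrev rel {A B : Rel S Q} (R : A ⟶ B) : A.alg.carrier ⊗ B.alg.carrier ⟶ Q.carrier :=
  Rel.Hom.rel R

@[ext]
lemma hom_ext {A B : Rel S Q} {R R' : A ⟶ B} (h : rel R = rel R') : R = R' := Rel.Hom.ext h

lemma rel_id (A : Rel S Q) : rel (𝟙 A) = idRel Q A.alg.carrier := rfl
lemma rel_comp {A B C : Rel S Q} (R : A ⟶ B) (R' : B ⟶ C) :
    rel (R ≫ R') = compRel (rel R) (rel R') := rfl

/-- The graph of an isomorphism of algebras, as an isomorphism. -/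
def graphIso {A B : Rel S Q} (f : A.alg.carrier ≅ B.alg.carrier) (h : A.alg.IsHom B.alg f.hom)
    (h' : B.alg.IsHom A.alg f.inv) : A ≅ B where
  hom := ⟨graphRel Q f.hom, IsAlgebraic.graph h⟩
  inv := ⟨graphRel Q f.inv, IsAlgebraic.graph h'⟩
  hom_inv_id := by
    apply hom_ext
    change compRel (graphRel Q f.hom) (graphRel Q f.inv) = graphRel Q (𝟙 _)
    rw [graphRel_comp, f.hom_inv_id]
  inv_hom_id := by
    apply hom_ext
    change compRel (graphRel Q f.inv) (graphRel Q f.hom) = graphRel Q (𝟙 _)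
    rw [graphRel_comp, f.inv_hom_id]

lemma isHom_assoc_hom (A B C : Algebra S E) :
    ((A.prod B).prod C).IsHom (A.prod (B.prod C))
      (α_ A.carrier B.carrier C.carrier).hom := by
  have e : (α_ A.carrier B.carrier C.carrier).hom =
      lift (fst _ _ ≫ fst _ _) (lift (fst _ _ ≫ snd _ _) (snd _ _)) := by
    ext <;> simp
  rw [e]
  have h1 := Algebra.isHom_fst (A.prod B) C
  exact (h1.comp (Algebra.isHom_fst A B)).lift
    ((h1.comp (Algebra.isHom_snd A B)).lift (Algebra.isHom_snd (A.prod B) C))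

lemma isHom_assoc_inv (A B C : Algebra S E) :
    (A.prod (B.prod C)).IsHom ((A.prod B).prod C)
      (α_ A.carrier B.carrier C.carrier).inv := by
  have e : (α_ A.carrier B.carrier C.carrier).inv =
      lift (lift (fst _ _) (snd _ _ ≫ fst _ _)) (snd _ _ ≫ snd _ _) := by
    ext <;> simp
  rw [e]
  have h1 := Algebra.isHom_snd A (B.prod C)
  exact ((Algebra.isHom_fst A (B.prod C)).lift (h1.comp (Algebra.isHom_fst B C))).lift
    (h1.comp (Algebra.isHom_snd B C))

lemma isHom_swap (A B : Algebra S E) :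
    (A.prod B).IsHom (B.prod A) (lift (snd A.carrier B.carrier) (fst A.carrier B.carrier)) :=
  (Algebra.isHom_snd A B).lift (Algebra.isHom_fst A B)

instance : MonoidalCategoryStruct (Rel S Q) where
  tensorObj A B := ⟨A.alg.prod B.alg⟩
  tensorUnit := ⟨Algebra.unit S E⟩
  tensorHom R R' := ⟨tensorRel R.rel R'.rel, R.algebraic.tensor R'.algebraic⟩
  whiskerLeft A _ _ R := ⟨tensorRel (idRel Q A.alg.carrier) R.rel,
    (IsAlgebraic.id A.alg).tensor R.algebraic⟩
  whiskerRight R A := ⟨tensorRel R.rel (idRel Q A.alg.carrier),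
    R.algebraic.tensor (IsAlgebraic.id A.alg)⟩
  associator A B C := graphIso (α_ A.alg.carrier B.alg.carrier C.alg.carrier)
    (isHom_assoc_hom _ _ _) (isHom_assoc_inv _ _ _)
  leftUnitor A := graphIso (λ_ A.alg.carrier)
    (by rw [leftUnitor_hom]; exact Algebra.isHom_snd (Algebra.unit S E) A.alg)
    (by
      have e : (λ_ A.alg.carrier).inv = lift (toUnit _) (𝟙 _) := by ext <;> simp
      rw [e]
      exact (Algebra.isHom_toUnit A.alg).lift A.alg.isHom_id)
  rightUnitor A := graphIso (ρ_ A.alg.carrier)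
    (by rw [rightUnitor_hom]; exact Algebra.isHom_fst A.alg (Algebra.unit S E))
    (by
      have e : (ρ_ A.alg.carrier).inv = lift (𝟙 _) (toUnit _) := by ext <;> simp
      rw [e]
      exact A.alg.isHom_id.lift (Algebra.isHom_toUnit A.alg))

instance : MonoidalCategory (Rel S Q) := MonoidalCategory.ofTensorHom
  (id_tensorHom_id := fun _ _ => hom_ext (tensorRel_id _ _))
  (id_tensorHom := fun _ _ _ _ => rfl)
  (tensorHom_id := fun _ _ => rfl)
  (tensorHom_comp_tensorHom := fun _ _ _ _ => hom_ext (tensorRel_compRel _ _ _ _))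
  (associator_naturality := fun _ _ _ => hom_ext (associatorRel_naturality _ _ _))
  (leftUnitor_naturality := fun _ => hom_ext (leftUnitorRel_naturality _))
  (rightUnitor_naturality := fun _ => hom_ext (rightUnitorRel_naturality _))
  (pentagon := fun _ _ _ _ => hom_ext (pentagonRel _ _ _ _))
  (triangle := fun _ _ => hom_ext (triangleRel _ _))

instance : SymmetricCategory (Rel S Q) where
  braiding A B := graphIso (swapIso A.alg.carrier B.alg.carrier) (isHom_swap _ _) (isHom_swap _ _)
  braiding_naturality_right A _ _ R := hom_ext (swapRel_naturality (idRel Q A.alg.carrier) R.rel)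
  braiding_naturality_left R A := hom_ext (swapRel_naturality R.rel (idRel Q A.alg.carrier))
  hexagon_forward _ _ _ := hom_ext (hexagonRel_forward _ _ _)
  hexagon_reverse _ _ _ := hom_ext (hexagonRel_reverse _ _ _)
  symmetry _ _ := hom_ext (swapRel_symmetry _ _)

end Rel

end RelCategory

section LogicalFunctors

/-- The morphism `t` is a subobject classifier: a monomorphism such that every monomorphism is the
pullback of `t` along a unique morphism. -/
def IsClassifier {F : Type u} [Category.{v} F] {Ω₀ Ω : F} (t : Ω₀ ⟶ Ω) : Prop :=
  Mono t ∧ ∀ {U X : F} (m : U ⟶ X) [Mono m],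
    ∃! c : X ⟶ Ω, ∃ c₀ : U ⟶ Ω₀, IsPullback m c₀ c t

lemma isClassifier_truth (F : Type u) [Category.{v} F] [HasSubobjectClassifier F] :
    IsClassifier (truth F) := by
  refine ⟨inferInstance, fun m hm => ⟨χ m, ⟨_, isPullback_χ m⟩, ?_⟩⟩
  rintro c ⟨c₀, hc⟩
  exact Subobject.Classifier.uniq _ m hc

lemma IsClassifier.of_iso {F : Type u} [Category.{v} F] {Ω₀ Ω Ω₀' Ω' : F} {t : Ω₀ ⟶ Ω}
    {t' : Ω₀' ⟶ Ω'} (h : IsClassifier t) (e₀ : Ω₀ ≅ Ω₀') (e : Ω ≅ Ω')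
    (w : t ≫ e.hom = e₀.hom ≫ t') : IsClassifier t' := by
  have := h.1
  have ht' : t' = e₀.inv ≫ t ≫ e.hom := by rw [w, Iso.inv_hom_id_assoc]
  have sq : IsPullback t e₀.hom e.hom t' := IsPullback.of_vert_isIso ⟨w⟩
  have sq' : IsPullback t' e₀.inv e.inv t := IsPullback.of_vert_isIso ⟨by rw [ht']; simp⟩
  refine ⟨by rw [ht']; infer_instance, fun m hm => ?_⟩
  obtain ⟨c, ⟨c₀, hc⟩, hu⟩ := h.2 m
  refine ⟨c ≫ e.hom, ⟨_, hc.paste_vert sq⟩, ?_⟩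
  rintro d ⟨d₀, hd⟩
  rw [← hu (d ≫ e.inv) ⟨_, hd.paste_vert sq'⟩]
  simp

/-- The comparison `L (B ^ A) ⟶ (L B) ^ (L A)` of exponentials: the transpose of
`L A ⊗ L (B ^ A) ≅ L (A ⊗ B ^ A) ⟶ L B`. -/
def expHom {E : Type u₁} [Category.{v₁} E] [ElementaryTopos E] {F : Type u₂} [Category.{v₂} F]
    [ElementaryTopos F] (L : E ⥤ F) [PreservesFiniteProducts L] (A B : E) :
    L.obj ((ihom A).obj B) ⟶ (ihom (L.obj A)).obj (L.obj B) :=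
  MonoidalClosed.curry (inv (prodComparison L A ((ihom A).obj B)) ≫ L.map ((ihom.ev A).app B))

/-- A logical functor between toposes: it preserves finite products, exponentials and the
subobject classifier. -/
class IsLogical {E : Type u₁} [Category.{v₁} E] [ElementaryTopos E] {F : Type u₂} [Category.{v₂} F]
    [ElementaryTopos F] (L : E ⥤ F) : Prop extends
    PreservesFiniteProducts L where
  isIso_expHom : ∀ A B : E, IsIso (expHom L A B)
  isClassifier : IsClassifier (L.map (truth E))

variable {E : Type u₁} [Category.{v₁} E] [ElementaryTopos E] {F : Type u₂} [Category.{v₂} F]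
  [ElementaryTopos F] {G : Type u₃} [Category.{v₃} G] [ElementaryTopos G]

section

variable (L : E ⥤ F) [IsLogical L]

instance : Mono (L.map (truth E)) := (IsLogical.isClassifier (L := L)).1

/-- The comparison of the objects of truth values. -/
def omegaHom : L.obj (Ω E) ⟶ Ω F := χ (L.map (truth E))

instance : IsIso (omegaHom L) := by
  obtain ⟨d, ⟨d₀, hd⟩, -⟩ := (IsLogical.isClassifier (L := L)).2 (truth F)
  have hc : IsPullback (L.map (truth E)) _ (omegaHom L) (truth F) :=
    isPullback_χ (L.map (truth E))
  obtain ⟨r, -, hr⟩ := (IsLogical.isClassifier (L := L)).2 (L.map (truth E))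
  refine ⟨d, ?_, ?_⟩
  · rw [hr _ ⟨_, hc.paste_vert hd⟩, hr (𝟙 _) ⟨𝟙 _, IsPullback.of_vert_isIso ⟨by simp⟩⟩]
  · rw [Subobject.Classifier.uniq _ _ (hd.paste_vert hc)]
    exact (Subobject.Classifier.uniq _ _
      (IsPullback.of_vert_isIso ⟨by simp⟩ : IsPullback (truth F) (𝟙 _) (𝟙 _) (truth F))).symm

/-- The comparison of power objects. -/
def powHom (A : E) : L.obj (Pow A) ⟶ Pow (L.obj A) :=
  expHom L A (Ω E) ≫ (ihom (L.obj A)).map (omegaHom L)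

instance (A : E) : IsIso (powHom L A) := by
  have := IsLogical.isIso_expHom (L := L) A (Ω E)
  unfold powHom
  infer_instance

lemma map_tt (X : E) : L.map (tt X) ≫ omegaHom L = tt (L.obj X) := by
  unfold tt omegaHom
  rw [L.map_comp, Category.assoc, HasSubobjectClassifier.comm, ← Category.assoc]
  congr 1
  exact Subsingleton.elim _ _

end

lemma expHom_id (A B : E) : expHom (𝟭 E) A B = 𝟙 ((ihom A).obj B) := by
  apply MonoidalClosed.uncurry_injective
  unfold expHom
  rw [MonoidalClosed.uncurry_curry]
  erw [MonoidalClosed.uncurry_id_eq_ev, IsIso.inv_comp_eq, prodComparison_id, Category.id_comp]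
  rfl

instance : IsLogical (𝟭 E) where
  isIso_expHom A B := by rw [expHom_id]; exact IsIso.id _
  isClassifier := isClassifier_truth E

lemma omegaHom_id : omegaHom (𝟭 E) = 𝟙 (Ω E) :=
  (Subobject.Classifier.uniq _ _
      (IsPullback.of_vert_isIso ⟨by simp⟩ : IsPullback (truth E) (𝟙 _) (𝟙 _) (truth E))).symm

lemma powHom_id (A : E) : powHom (𝟭 E) A = 𝟙 (Pow A) := by
  unfold powHom
  rw [expHom_id, omegaHom_id]
  exact (Category.id_comp _).trans ((ihom A).map_id _)

lemma uncurry_expHom (L : E ⥤ F) [PreservesFiniteProducts L] (A B : E) :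
    MonoidalClosed.uncurry (expHom L A B) =
      inv (prodComparison L A ((ihom A).obj B)) ≫ L.map ((ihom.ev A).app B) :=
  MonoidalClosed.uncurry_curry _

lemma whiskerLeft_comp_inv_prodComparison (L : E ⥤ F) [PreservesFiniteProducts L] (A : E)
    {B C : E} (f : B ⟶ C) :
    L.obj A ◁ L.map f ≫ inv (prodComparison L A C) =
      inv (prodComparison L A B) ≫ L.map (A ◁ f) := by
  rw [IsIso.comp_inv_eq, Category.assoc, prodComparison_natural_whiskerLeft,
    IsIso.inv_hom_id_assoc]

lemma inv_eq_of_eq_map_comp (K : F ⥤ G) {a b : F} {c : G} (f : a ⟶ b) [IsIso f]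
    (g : K.obj b ⟶ c) [IsIso g] (h : K.obj a ⟶ c) [IsIso h] (w : h = K.map f ≫ g) :
    inv h = inv g ≫ K.map (inv f) := by
  subst w
  simp

lemma inv_eq_id {A : E} (f : A ⟶ A) [IsIso f] (w : f = 𝟙 A) : inv f = 𝟙 A := by
  subst w
  simp

lemma inv_prodComparison_comp (L : E ⥤ F) (K : F ⥤ G) [PreservesFiniteProducts L]
    [PreservesFiniteProducts K] (A B : E) :
    inv (prodComparison (L ⋙ K) A B) =
      inv (prodComparison K (L.obj A) (L.obj B)) ≫ K.map (inv (prodComparison L A B)) := by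
  exact inv_eq_of_eq_map_comp K (prodComparison L A B)
    (prodComparison K (L.obj A) (L.obj B)) (prodComparison (L ⋙ K) A B) (prodComparison_comp L K)

lemma expHom_comp (L : E ⥤ F) (K : F ⥤ G) [PreservesFiniteProducts L] [PreservesFiniteProducts K]
    (A B : E) :
    expHom (L ⋙ K) A B = K.map (expHom L A B) ≫ expHom K (L.obj A) (L.obj B) := by
  apply MonoidalClosed.uncurry_injective
  have h1 := whiskerLeft_comp_inv_prodComparison K (L.obj A) (expHom L A B)
  have h2 := uncurry_expHom L A B
  rw [MonoidalClosed.uncurry_eq] at h2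
  have h3 : MonoidalClosed.uncurry (K.map (expHom L A B) ≫ expHom K (L.obj A) (L.obj B)) =
      inv (prodComparison K (L.obj A) (L.obj ((ihom A).obj B))) ≫
        K.map (inv (prodComparison L A ((ihom A).obj B)) ≫ L.map ((ihom.ev A).app B)) := by
    rw [MonoidalClosed.uncurry_natural_left, uncurry_expHom, ← Category.assoc, h1, Category.assoc,
      ← K.map_comp, h2]
  rw [uncurry_expHom, inv_prodComparison_comp]
  refine Eq.trans ?_ h3.symm
  rw [K.map_comp, Category.assoc]
  rfl

lemma expHom_naturality (L : E ⥤ F) [PreservesFiniteProducts L] (A : E) {B C : E} (f : B ⟶ C) :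
    L.map ((ihom A).map f) ≫ expHom L A C =
      expHom L A B ≫ (ihom (L.obj A)).map (L.map f) := by
  apply MonoidalClosed.uncurry_injective
  rw [MonoidalClosed.uncurry_natural_left, MonoidalClosed.uncurry_natural_right, uncurry_expHom,
    uncurry_expHom, ← Category.assoc, whiskerLeft_comp_inv_prodComparison, Category.assoc,
    Category.assoc, ← L.map_comp, ← L.map_comp, ihom.ev_naturality]

lemma isPullback_map_truth (L : E ⥤ F) (K : F ⥤ G) [IsLogical L] [IsLogical K] :
    ∃ e : K.obj (L.obj (Ω₀ E)) ≅ K.obj (Ω₀ F),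
      K.map (L.map (truth E)) ≫ K.map (omegaHom L) = e.hom ≫ K.map (truth F) := by
  have hc : IsPullback (L.map (truth E)) _ (omegaHom L) (truth F) :=
    isPullback_χ (L.map (truth E))
  have := hc.isIso_snd_of_isIso
  exact ⟨K.mapIso (asIso (Subobject.Classifier.χ₀ _ (L.obj (Ω₀ E)))), by
    rw [← K.map_comp, hc.w, K.map_comp]; rfl⟩

instance (L : E ⥤ F) (K : F ⥤ G) [IsLogical L] [IsLogical K] : IsLogical (L ⋙ K) where
  isIso_expHom A B := by
    have := IsLogical.isIso_expHom (L := L) A B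
    have := IsLogical.isIso_expHom (L := K) (L.obj A) (L.obj B)
    rw [expHom_comp]
    infer_instance
  isClassifier := by
    obtain ⟨e, he⟩ := isPullback_map_truth L K
    refine (IsLogical.isClassifier (L := K)).of_iso e.symm (K.mapIso (asIso (omegaHom L))).symm ?_
    simp only [Iso.symm_hom, Functor.mapIso_inv, asIso_inv]
    rw [Iso.eq_inv_comp, ← Category.assoc, ← he, Category.assoc, ← K.map_comp]
    simp

lemma omegaHom_comp (L : E ⥤ F) (K : F ⥤ G) [IsLogical L] [IsLogical K] :
    omegaHom (L ⋙ K) = K.map (omegaHom L) ≫ omegaHom K := by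
  obtain ⟨e, he⟩ := isPullback_map_truth L K
  have h1 : IsPullback (K.map (L.map (truth E))) e.hom (K.map (omegaHom L)) (K.map (truth F)) :=
    IsPullback.of_vert_isIso ⟨he⟩
  exact (Subobject.Classifier.uniq _ ((L ⋙ K).map (truth E))
    (h1.paste_vert (isPullback_χ (K.map (truth F))))).symm

lemma powHom_comp (L : E ⥤ F) (K : F ⥤ G) [IsLogical L] [IsLogical K] (A : E) :
    powHom (L ⋙ K) A = K.map (powHom L A) ≫ powHom K (L.obj A) := by
  unfold powHom
  rw [expHom_comp, omegaHom_comp, K.map_comp, Category.assoc, Category.assoc,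
    ← Category.assoc (K.map ((ihom _).map _)), expHom_naturality, Category.assoc,
    ← (ihom _).map_comp]
  rfl

end LogicalFunctors

section Transport

variable {E : Type u₁} [Category.{v₁} E] [ElementaryTopos E] {F : Type u₂} [Category.{v₂} F]
  [ElementaryTopos F] {G : Type u₃} [Category.{v₃} G] [ElementaryTopos G]

/-- The canonical isomorphism `L A ⊗ L B ⟶ L (A ⊗ B)`. -/
def kappa (L : E ⥤ F) [PreservesFiniteProducts L] (A B : E) :
    L.obj A ⊗ L.obj B ⟶ L.obj (A ⊗ B) := inv (prodComparison L A B)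

/-- The canonical isomorphism `(L A) ^ n ⟶ L (A ^ n)`. -/
def kappaPow (L : E ⥤ F) [PreservesFiniteProducts L] (n : ℕ) (A : E) :
    (∏ᶜ fun _ : Fin n => L.obj A) ⟶ L.obj (∏ᶜ fun _ : Fin n => A) :=
  inv (piComparison L fun _ : Fin n => A)

/-- The image of (the data of) an internal quantale under a logical functor. -/
abbrev QuantaleData.map (Q : QuantaleData E) (L : E ⥤ F) [IsLogical L] : QuantaleData F where
  carrier := L.obj Q.carrier
  mul := kappa L Q.carrier Q.carrier ≫ L.map Q.mul
  unit := inv (terminalComparison L) ≫ L.map Q.unit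
  le := kappa L Q.carrier Q.carrier ≫ L.map Q.le ≫ omegaHom L
  sup := inv (powHom L Q.carrier) ≫ L.map Q.sup

lemma kappa_id (A B : E) : kappa (𝟭 E) A B = 𝟙 (A ⊗ B) := by
  exact inv_eq_id _ prodComparison_id

lemma kappa_comp (L : E ⥤ F) (K : F ⥤ G) [PreservesFiniteProducts L] [PreservesFiniteProducts K]
    (A B : E) : kappa (L ⋙ K) A B = kappa K (L.obj A) (L.obj B) ≫ K.map (kappa L A B) :=
  inv_prodComparison_comp L K A B

lemma lift_map_kappa (L : E ⥤ F) [PreservesFiniteProducts L] {X A B : E} (a : X ⟶ A)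
    (b : X ⟶ B) : lift (L.map a) (L.map b) ≫ kappa L A B = L.map (lift a b) := by
  unfold kappa
  rw [IsIso.comp_inv_eq]
  ext <;> simp [← L.map_comp]

lemma piLift_map_kappaPow (L : E ⥤ F) [PreservesFiniteProducts L] {X A : E} {n : ℕ}
    (a : Fin n → (X ⟶ A)) :
    Pi.lift (fun i => L.map (a i)) ≫ kappaPow L n A = L.map (Pi.lift a) := by
  unfold kappaPow
  rw [IsIso.comp_inv_eq, map_lift_piComparison]

lemma kappaPow_id (n : ℕ) (A : E) : kappaPow (𝟭 E) n A = 𝟙 (∏ᶜ fun _ : Fin n => A) := by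
  have h := piLift_map_kappaPow (𝟭 E) (fun i => Pi.π (fun _ : Fin n => A) i)
  have e : Pi.lift (fun i => Pi.π (fun _ : Fin n => A) i) = 𝟙 _ := by ext i; simp
  exact (Category.id_comp _).symm.trans
    ((congrArg (· ≫ kappaPow (𝟭 E) n A) e.symm).trans (h.trans e))

lemma kappaPow_comp (L : E ⥤ F) (K : F ⥤ G) [PreservesFiniteProducts L]
    [PreservesFiniteProducts K] (n : ℕ) (A : E) :
    kappaPow (L ⋙ K) n A = kappaPow K n (L.obj A) ≫ K.map (kappaPow L n A) := by
  refine inv_eq_of_eq_map_comp K (piComparison L fun _ : Fin n => A)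
    (piComparison K fun _ : Fin n => L.obj A) (piComparison (L ⋙ K) fun _ : Fin n => A) ?_
  apply Pi.hom_ext
  intro i
  have h1 : K.map (L.map (Pi.π (fun _ : Fin n => A) i)) = _ :=
    (piComparison_comp_π (L ⋙ K) (fun _ : Fin n => A) i).symm
  have h2 : piComparison K (fun _ : Fin n => L.obj A) ≫ Pi.π (fun _ => (L ⋙ K).obj A) i =
      K.map (Pi.π (fun _ : Fin n => L.obj A) i) :=
    piComparison_comp_π K (fun _ : Fin n => L.obj A) i
  rw [← h1, Category.assoc, h2, ← K.map_comp, piComparison_comp_π]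

lemma QuantaleData.map_id (Q : QuantaleData E) : Q.map (𝟭 E) = Q := by
  have h : inv (terminalComparison (𝟭 E)) = 𝟙 (𝟙_ E) := Subsingleton.elim (α := _ ⟶ 𝟙_ E) _ _
  have h' : inv (powHom (𝟭 E) Q.carrier) = 𝟙 (Pow Q.carrier) := 
    inv_eq_id _ (powHom_id _)
  unfold QuantaleData.map
  rw [kappa_id, omegaHom_id, h, h']
  ext1 <;> simp

lemma QuantaleData.map_comp (Q : QuantaleData E) (L : E ⥤ F) (K : F ⥤ G) [IsLogical L]
    [IsLogical K] : Q.map (L ⋙ K) = (Q.map L).map K := by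
  have h : inv (terminalComparison (L ⋙ K)) =
      inv (terminalComparison K) ≫ K.map (inv (terminalComparison L)) := 
    inv_eq_of_eq_map_comp K (terminalComparison L) (terminalComparison K)
      (terminalComparison (L ⋙ K)) (Subsingleton.elim _ _)
  have h' : inv (powHom (L ⋙ K) Q.carrier) =
      inv (powHom K (L.obj Q.carrier)) ≫ K.map (inv (powHom L Q.carrier)) := 
    inv_eq_of_eq_map_comp K (powHom L Q.carrier) (powHom K (L.obj Q.carrier))
      (powHom (L ⋙ K) Q.carrier) (powHom_comp L K Q.carrier)
  unfold QuantaleData.map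
  rw [kappa_comp, omegaHom_comp, h, h']
  ext1 <;> simp

variable {S : Signature.{w}}

lemma lift_op_map (L : E ⥤ F) [PreservesFiniteProducts L] {A X : E} {n : ℕ}
    (op : (∏ᶜ fun _ : Fin n => A) ⟶ A) (a : Fin n → (X ⟶ A)) :
    Pi.lift (fun i => L.map (a i)) ≫ kappaPow L n A ≫ L.map op = L.map (Pi.lift a ≫ op) := by
  rw [← Category.assoc, piLift_map_kappaPow, L.map_comp]

lemma Term.map_eval (L : E ⥤ F) [PreservesFiniteProducts L] {A : E}
    (op : ∀ σ : S.Op, (∏ᶜ fun _ : Fin (S.arity σ) => A) ⟶ A)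
    {n : ℕ} {X : E} (ρ : Fin n → (X ⟶ A)) (t : Term S.arity n) :
    t.eval (fun σ => kappaPow L (S.arity σ) A ≫ L.map (op σ)) (fun i => L.map (ρ i)) =
      L.map (t.eval op ρ) := by
  induction t with
  | var i => rfl
  | app σ args ih => simp only [Term.eval, ih, lift_op_map]

lemma kappaPow_map_π (L : E ⥤ F) [PreservesFiniteProducts L] {A : E} {n : ℕ} (i : Fin n) :
    kappaPow L n A ≫ L.map (Pi.π (fun _ : Fin n => A) i) = Pi.π (fun _ : Fin n => L.obj A) i := by
  unfold kappaPow
  rw [IsIso.inv_comp_eq, piComparison_comp_π]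

/-- The image of an algebra under a functor preserving finite products. -/
abbrev Algebra.map (A : Algebra S E) (L : E ⥤ F) [PreservesFiniteProducts L] : Algebra S F where
  carrier := L.obj A.carrier
  op σ := kappaPow L (S.arity σ) A.carrier ≫ L.map (A.op σ)
  eqs n e he := by
    have key : ∀ t : Term S.arity n,
        t.eval (fun σ => kappaPow L (S.arity σ) A.carrier ≫ L.map (A.op σ))
          (fun i => Pi.π (fun _ : Fin n => L.obj A.carrier) i) =
        kappaPow L n A.carrier ≫ L.map (t.eval A.op fun i => Pi.π (fun _ : Fin n => A.carrier) i) := by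
      intro t
      rw [← Term.map_eval, Term.comp_eval]
      simp only [kappaPow_map_π]
    rw [key, key, A.eqs n e he]

/-- The image `L A ⊗ L B ⟶ L (A ⊗ B) ⟶ L Q` of a `Q`-relation. -/
def mapRel {Q : QuantaleData E} (L : E ⥤ F) [IsLogical L] {A B : E} (R : A ⊗ B ⟶ Q.carrier) :
    L.obj A ⊗ L.obj B ⟶ (Q.map L).carrier := kappa L A B ≫ L.map R

section

variable {Q : QuantaleData E} (L : E ⥤ F) [IsLogical L]

lemma map_ap {A B X : E} (R : A ⊗ B ⟶ Q.carrier) (a : X ⟶ A) (b : X ⟶ B) :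
    L.map (ap R a b) = ap (Q := Q.map L) (mapRel L R) (L.map a) (L.map b) := by
  unfold ap mapRel
  rw [← Category.assoc, lift_map_kappa, L.map_comp]

lemma map_m {X : E} (x y : X ⟶ Q.carrier) :
    L.map (Q.m x y) = (Q.map L).m (L.map x) (L.map y) := by
  unfold QuantaleData.m
  rw [L.map_comp, ← lift_map_kappa, Category.assoc]

lemma map_one (X : E) : L.map (Q.one X) = (Q.map L).one (L.obj X) := by
  unfold QuantaleData.one
  rw [L.map_comp, ← Category.assoc]
  congr 1
  rw [IsIso.eq_comp_inv]
  exact Subsingleton.elim _ _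

lemma map_prod {X : E} {n : ℕ} (x : Fin n → (X ⟶ Q.carrier)) :
    L.map (Q.prod x) = (Q.map L).prod (fun i => L.map (x i)) := by
  induction n with
  | zero => exact map_one L X
  | succ n ih => rw [QuantaleData.prod, map_m, ih]; rfl

lemma Le.map {X : E} {x y : X ⟶ Q.carrier} (h : Q.Le x y) :
    (Q.map L).Le (X := L.obj X) (L.map x) (L.map y) := by
  unfold QuantaleData.Le at h ⊢
  have : lift (L.map x) (L.map y) ≫ kappa L Q.carrier Q.carrier ≫ L.map Q.le ≫ omegaHom L =
      tt (L.obj X) := by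
    rw [← Category.assoc, lift_map_kappa, ← Category.assoc, ← L.map_comp, h, map_tt]
  exact this

lemma IsAlgebraic.map {A B : Algebra S E} {R : A.carrier ⊗ B.carrier ⟶ Q.carrier}
    (h : IsAlgebraic A B R) : IsAlgebraic (Q := Q.map L) (A.map L) (B.map L) (mapRel L R) := by
  intro σ X a b
  let n := S.arity σ
  let PA := ∏ᶜ fun _ : Fin n => A.carrier
  let PB := ∏ᶜ fun _ : Fin n => B.carrier
  let a' : Fin n → (PA ⊗ PB ⟶ A.carrier) := fun i => fst PA PB ≫ Pi.π (fun _ : Fin n => A.carrier) i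
  let b' : Fin n → (PA ⊗ PB ⟶ B.carrier) := fun i => snd PA PB ≫ Pi.π (fun _ : Fin n => B.carrier) i
  have h' := Le.map L (h σ _ a' b')
  rw [map_prod] at h'
  simp only [map_ap] at h'
  let f : X ⟶ L.obj (PA ⊗ PB) :=
    lift (Pi.lift a ≫ kappaPow L n A.carrier) (Pi.lift b ≫ kappaPow L n B.carrier) ≫ kappa L PA PB
  have f1 : f ≫ L.map (fst PA PB) = Pi.lift a ≫ kappaPow L n A.carrier := by
    simp only [f, kappa, Category.assoc, CartesianMonoidalCategory.inv_prodComparison_map_fst]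
    exact lift_fst _ _
  have f2 : f ≫ L.map (snd PA PB) = Pi.lift b ≫ kappaPow L n B.carrier := by
    simp only [f, kappa, Category.assoc, CartesianMonoidalCategory.inv_prodComparison_map_snd]
    exact lift_snd _ _
  have ha : ∀ i, f ≫ L.map (a' i) = a i := by
    intro i
    rw [L.map_comp, ← Category.assoc, f1, Category.assoc, kappaPow_map_π, Pi.lift_π]
  have hb : ∀ i, f ≫ L.map (b' i) = b i := by
    intro i
    rw [L.map_comp, ← Category.assoc, f2, Category.assoc, kappaPow_map_π, Pi.lift_π]
  have h'' := h'.comp f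
  rw [comp_prod, comp_ap] at h''
  simp only [comp_ap, ha, hb] at h''
  refine cast ?_ h''
  congr 2
  · have e : Pi.lift a' = fst PA PB := by ext i; simp [a']
    rw [L.map_comp, e, ← Category.assoc, f1, Category.assoc]
  · have e : Pi.lift b' = snd PA PB := by ext i; simp [b']
    rw [L.map_comp, e, ← Category.assoc, f2, Category.assoc]

end

end Transport

section Induced

/-- A (strong) symmetric monoidal functor. -/
structure SymMonFunctor (C : Type u₁) [Category.{v₁} C] [MonoidalCategory C] [SymmetricCategory C]
    (D : Type u₂) [Category.{v₂} D] [MonoidalCategory D] [SymmetricCategory D] extends C ⥤ D where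
  /-- the monoidal structure, compatible with the symmetries -/
  braided : toFunctor.Braided

namespace SymMonFunctor

/-- The identity symmetric monoidal functor. -/
def id (C : Type u₁) [Category.{v₁} C] [MonoidalCategory C] [SymmetricCategory C] :
    SymMonFunctor C C where
  toFunctor := 𝟭 C
  braided := inferInstance

/-- The composite of two symmetric monoidal functors. -/
def comp {C : Type u₁} [Category.{v₁} C] [MonoidalCategory C] [SymmetricCategory C]
    {D : Type u₂} [Category.{v₂} D] [MonoidalCategory D] [SymmetricCategory D]
    {D' : Type u₃} [Category.{v₃} D'] [MonoidalCategory D'] [SymmetricCategory D']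
    (G : SymMonFunctor C D) (H : SymMonFunctor D D') : SymMonFunctor C D' where
  toFunctor := G.toFunctor ⋙ H.toFunctor
  braided :=
    let _ := G.braided
    let _ := H.braided
    inferInstance

end SymMonFunctor

/-- The assignment `A ↦ L A`, `R ↦ (L A ⊗ L B ≅ L (A ⊗ B) ⟶ L Q)` on algebras and algebraic
relations, where `L Q = Q'`. -/
def relMap (S : Signature.{w}) {E : Type u₁} [Category.{v₁} E] [ElementaryTopos E] {F : Type u₂}
    [Category.{v₂} F] [ElementaryTopos F] (L : E ⥤ F) [IsLogical L]
    (Q : QuantaleData E) [Q.IsCommQuantale] (Q' : QuantaleData F) [Q'.IsCommQuantale]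
    (h : Q.map L = Q') : Rel S Q ⥤q Rel S Q' where
  obj A := ⟨A.alg.map L⟩
  map {A B} R := ⟨mapRel L (Rel.rel R) ≫ eqToHom (congrArg QuantaleData.carrier h), by
    subst h
    rw [eqToHom_refl, Category.comp_id]
    exact IsAlgebraic.map L (Rel.Hom.algebraic R)⟩

end Induced

end

end ToposRel

open ToposRel

/-!
A logical functor preserves the interpretation of every formula built from equality, conjunction,
membership and relativised universal quantification. Following Lambek and Scott, the last three
reduce to equality of truth values and of subobjects, so it suffices that equality be preserved;
and two elements are equal exactly when the singleton of the first contains the second.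

The laws of a quantale relating order, multiplication and joins amount to the single formula
`a ⊗ ⋁ S ≤ z ↔ ∀ s ∈ S, a ⊗ s ≤ z`, which is of this kind, so they pass to `L Q`. In the same way
the join of a family `(q i)` over the fibres of `f` is characterised by its upper bounds, through
`⋁ {q i | f i = x} ≤ z ↔ ∀ i, f i = x → q i ≤ z`, so `L` preserves joins of families. Identities and
composites of relations are such joins, hence `R ↦ κ ≫ L R` is a functor. Its coherence data are
the graphs of the canonical isomorphisms `κ`; taking graphs is functorial and monoidal, so the
coherence laws, and the functoriality in `L`, follow from those of `κ`.
-/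

namespace ToposRel

noncomputable section

open HasSubobjectClassifier QuantaleData

section InternalLogic

variable {E : Type u} [Category.{v} E] [ElementaryTopos E]

instance (A : E) : Mono (lift (𝟙 A) (𝟙 A)) := mono_lift_of_mono_left _ _

/-- The truth value of `a = b`, at stage `X`: the characteristic map of the diagonal. -/
def eqPred {A X : E} (a b : X ⟶ A) : X ⟶ Ω E := lift a b ≫ χ (lift (𝟙 A) (𝟙 A))

lemma comp_eqPred_eq_tt_iff {A X T : E} (p : T ⟶ X) (a b : X ⟶ A) :
    p ≫ eqPred a b = tt T ↔ p ≫ a = p ≫ b := by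
  rw [eqPred, ← Category.assoc, comp_lift, comp_chi_eq_tt_iff]
  refine ⟨fun ⟨l, hl⟩ => ?_, fun h => ⟨p ≫ a, by rw [comp_lift, Category.comp_id, h]⟩⟩
  have h₁ := hl =≫ fst _ _
  have h₂ := hl =≫ snd _ _
  simp only [Category.assoc, lift_fst, lift_snd, Category.comp_id] at h₁ h₂
  exact h₁.symm.trans h₂

lemma eqPred_comp_mono {A B X : E} (a b : X ⟶ A) (m : A ⟶ B) [Mono m] :
    eqPred (a ≫ m) (b ≫ m) = eqPred a b :=
  omega_ext fun T p => by
    simp only [comp_eqPred_eq_tt_iff, ← Category.assoc, cancel_mono]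

/-- The truth value of `φ ∧ ψ`, encoded as `(φ, ψ) = (true, true)`. -/
def conj {X : E} (φ ψ : X ⟶ Ω E) : X ⟶ Ω E := eqPred (lift φ ψ) (lift (tt X) (tt X))

lemma comp_conj_eq_tt_iff {X T : E} (p : T ⟶ X) (φ ψ : X ⟶ Ω E) :
    p ≫ conj φ ψ = tt T ↔ p ≫ φ = tt T ∧ p ≫ ψ = tt T := by
  rw [conj, comp_eqPred_eq_tt_iff, comp_lift, comp_lift, comp_tt]
  refine ⟨fun h => ⟨?_, ?_⟩, fun ⟨h₁, h₂⟩ => by rw [h₁, h₂]⟩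
  · simpa only [lift_fst] using h =≫ fst _ _
  · simpa only [lift_snd] using h =≫ snd _ _

lemma comp_conj {X Y : E} (f : Y ⟶ X) (φ ψ : X ⟶ Ω E) :
    f ≫ conj φ ψ = conj (f ≫ φ) (f ≫ ψ) :=
  omega_ext fun T p => by
    rw [← Category.assoc, comp_conj_eq_tt_iff, comp_conj_eq_tt_iff, Category.assoc, Category.assoc]

lemma tt_conj {X : E} (φ : X ⟶ Ω E) : conj (tt X) φ = φ :=
  omega_ext fun T p => by rw [comp_conj_eq_tt_iff, comp_tt, and_iff_right rfl]

lemma pow_ext {A X : E} {S S' : X ⟶ Pow A}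
    (h : ∀ (T : E) (f : T ⟶ X) (a : T ⟶ A), mem a (f ≫ S) = tt T ↔ mem a (f ≫ S') = tt T) :
    S = S' := by
  have comp_uncurry : ∀ (S : X ⟶ Pow A) {T : E} (p : T ⟶ A ⊗ X),
      p ≫ MonoidalClosed.uncurry S = mem (p ≫ fst _ _) ((p ≫ snd _ _) ≫ S) := fun S T p => by
    have : p ≫ A ◁ S = lift (p ≫ fst _ _) ((p ≫ snd _ _) ≫ S) := by ext <;> simp
    rw [MonoidalClosed.uncurry_eq, ← Category.assoc, this, mem]
  refine MonoidalClosed.uncurry_injective (omega_ext fun T p => ?_)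
  rw [comp_uncurry, comp_uncurry]
  exact h T _ _

/-- The truth value of `∀ a, θ(a, x) → φ(a, x)`, encoded as `{a | θ ∧ φ} = {a | θ}`. -/
def forallImp {A X : E} (θ φ : A ⊗ X ⟶ Ω E) : X ⟶ Ω E :=
  eqPred (comprehension (conj θ φ)) (comprehension θ)

lemma comp_forallImp_eq_tt_iff {A X T : E} (p : T ⟶ X) (θ φ : A ⊗ X ⟶ Ω E) :
    p ≫ forallImp θ φ = tt T ↔ ∀ (V : E) (f : V ⟶ T) (a : V ⟶ A),
      lift a (f ≫ p) ≫ θ = tt V → lift a (f ≫ p) ≫ φ = tt V := by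
  have mem_comp : ∀ {V : E} (f : V ⟶ T) (a : V ⟶ A) (ψ : A ⊗ X ⟶ Ω E),
      mem a (f ≫ p ≫ comprehension ψ) = lift a (f ≫ p) ≫ ψ := fun f a ψ => by
    rw [← Category.assoc, mem_comprehension]
  rw [forallImp, comp_eqPred_eq_tt_iff]
  refine ⟨fun h V f a ha => ?_, fun h => pow_ext fun V f a => ?_⟩
  · rw [← mem_comp, ← h, mem_comp, comp_conj_eq_tt_iff] at ha
    exact ha.2
  · rw [mem_comp, mem_comp, comp_conj_eq_tt_iff]
    exact and_iff_left_of_imp (h V f a)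

end InternalLogic

section LogicalFunctor

variable {E : Type u₁} [Category.{v₁} E] [ElementaryTopos E] {F : Type u₂} [Category.{v₂} F]
  [ElementaryTopos F]

section FiniteProducts

variable (L : E ⥤ F) [PreservesFiniteProducts L]

lemma kappa_map_fst (A B : E) : kappa L A B ≫ L.map (fst A B) = fst _ _ :=
  inv_prodComparison_map_fst L A B

lemma kappa_map_snd (A B : E) : kappa L A B ≫ L.map (snd A B) = snd _ _ :=
  inv_prodComparison_map_snd L A B

lemma kappa_map_fst_assoc (A B : E) {T : F} (g : L.obj A ⟶ T) :
    kappa L A B ≫ L.map (fst A B) ≫ g = fst _ _ ≫ g := by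
  rw [← Category.assoc, kappa_map_fst]

lemma kappa_map_snd_assoc (A B : E) {T : F} (g : L.obj B ⟶ T) :
    kappa L A B ≫ L.map (snd A B) ≫ g = snd _ _ ≫ g := by
  rw [← Category.assoc, kappa_map_snd]

lemma comp_map_lift {X A B : E} {T : F} (x : T ⟶ L.obj X) (a : X ⟶ A) (b : X ⟶ B) :
    x ≫ L.map (lift a b) = lift (x ≫ L.map a) (x ≫ L.map b) ≫ kappa L A B := by
  rw [← lift_map_kappa, ← Category.assoc, comp_lift]

end FiniteProducts

variable (L : E ⥤ F) [IsLogical L]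

/-- The image of a predicate under a logical functor. -/
def mapPred {X : E} (φ : X ⟶ Ω E) : L.obj X ⟶ Ω F := L.map φ ≫ omegaHom L

lemma map_comp_mapPred {X Y : E} (f : X ⟶ Y) (φ : Y ⟶ Ω E) :
    L.map f ≫ mapPred L φ = mapPred L (f ≫ φ) := by
  rw [mapPred, mapPred, L.map_comp, Category.assoc]

lemma comp_mapPred_eq_tt_iff {X : E} {T : F} (x : T ⟶ L.obj X) (φ : X ⟶ Ω E) :
    x ≫ mapPred L φ = tt T ↔ x ≫ L.map φ = x ≫ L.map (tt X) := by
  rw [mapPred, ← cancel_mono (omegaHom L), Category.assoc, Category.assoc, map_tt, comp_tt]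

lemma comp_mapPred_conj_of_left {X : E} {φ : X ⟶ Ω E} (ψ : X ⟶ Ω E) {T : F} {x : T ⟶ L.obj X}
    (hφ : x ≫ mapPred L φ = tt T) : x ≫ mapPred L (conj φ ψ) = x ≫ mapPred L ψ := by
  have map_conj : ∀ φ, x ≫ mapPred L (conj φ ψ) = lift (x ≫ L.map φ) (x ≫ L.map ψ) ≫
      kappa L _ _ ≫ mapPred L (conj (fst _ _) (snd _ _)) := fun φ => by
    rw [← Category.assoc (lift _ _), ← comp_map_lift, Category.assoc, map_comp_mapPred, comp_conj,
      lift_fst, lift_snd]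
  rw [comp_mapPred_eq_tt_iff] at hφ
  rw [map_conj, hφ, ← map_conj, tt_conj]

lemma comp_mapPred_of_entails {X : E} {φ ψ : X ⟶ Ω E}
    (h : ∀ (T : E) (p : T ⟶ X), p ≫ φ = tt T → p ≫ ψ = tt T)
    {T : F} {x : T ⟶ L.obj X} (hx : x ≫ mapPred L φ = tt T) : x ≫ mapPred L ψ = tt T := by
  have conj_eq : conj φ ψ = φ := omega_ext fun T p => by
    rw [comp_conj_eq_tt_iff]
    exact and_iff_left_of_imp (h T p)
  rw [← comp_mapPred_conj_of_left L ψ hx, conj_eq, hx]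

lemma mapPred_conj {X : E} (φ ψ : X ⟶ Ω E) :
    mapPred L (conj φ ψ) = conj (mapPred L φ) (mapPred L ψ) :=
  omega_ext fun T x => by
    rw [comp_conj_eq_tt_iff]
    refine ⟨fun h => ⟨?_, ?_⟩, fun ⟨hφ, hψ⟩ => (comp_mapPred_conj_of_left L ψ hφ).trans hψ⟩
    · exact comp_mapPred_of_entails L (fun T p hp => ((comp_conj_eq_tt_iff p φ ψ).1 hp).1) h
    · exact comp_mapPred_of_entails L (fun T p hp => ((comp_conj_eq_tt_iff p φ ψ).1 hp).2) h

lemma comp_mapPred_of_entails₂ {X : E} {φ₁ φ₂ ψ : X ⟶ Ω E}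
    (h : ∀ (T : E) (p : T ⟶ X), p ≫ φ₁ = tt T → p ≫ φ₂ = tt T → p ≫ ψ = tt T)
    {T : F} {x : T ⟶ L.obj X} (h₁ : x ≫ mapPred L φ₁ = tt T) (h₂ : x ≫ mapPred L φ₂ = tt T) :
    x ≫ mapPred L ψ = tt T := by
  refine comp_mapPred_of_entails L (φ := conj φ₁ φ₂) (fun T p hp => ?_) ?_
  · rw [comp_conj_eq_tt_iff] at hp
    exact h T p hp.1 hp.2
  · rw [mapPred_conj, comp_conj_eq_tt_iff]
    exact ⟨h₁, h₂⟩

lemma mem_comp_powHom {A : E} {T : F} (a : T ⟶ L.obj A) (S : T ⟶ L.obj (Pow A)) :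
    mem a (S ≫ powHom L A) = lift a S ≫ kappa L A (Pow A) ≫ mapPred L ((ihom.ev A).app (Ω E)) := by
  have h := uncurry_expHom L A (Ω E)
  rw [MonoidalClosed.uncurry_eq] at h
  have e : lift a (S ≫ powHom L A) = lift a S ≫ L.obj A ◁ expHom L A (Ω E) ≫
      L.obj A ◁ (ihom (L.obj A)).map (omegaHom L) := by
    unfold powHom
    ext <;> simp
  rw [mem, e, Category.assoc, Category.assoc, ihom.ev_naturality,
    ← Category.assoc (L.obj A ◁ expHom L A (Ω E)), h, Category.assoc]
  rfl

lemma mapPred_mem {A X : E} (a : X ⟶ A) (S : X ⟶ Pow A) :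
    mapPred L (mem a S) = mem (L.map a) (L.map S ≫ powHom L A) := by
  rw [mem_comp_powHom, ← Category.assoc, lift_map_kappa, map_comp_mapPred, mem]

lemma map_comprehension {A X : E} (P : A ⊗ X ⟶ Ω E) :
    L.map (comprehension P) ≫ powHom L A = comprehension (kappa L A X ≫ mapPred L P) := by
  have lift_eq : ∀ {T : F} (a : T ⟶ L.obj A) (f : T ⟶ L.obj X),
      lift a (f ≫ L.map (comprehension P)) ≫ kappa L A (Pow A) =
        (lift a f ≫ kappa L A X) ≫ L.map (lift (fst A X) (snd A X ≫ comprehension P)) :=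
    fun a f => by
      rw [comp_map_lift, L.map_comp]
      simp only [Category.assoc, kappa_map_fst, kappa_map_snd_assoc, lift_fst, lift_snd_assoc]
  refine pow_ext fun T f a => ?_
  rw [mem_comprehension, ← Category.assoc, mem_comp_powHom, ← Category.assoc, lift_eq,
    Category.assoc, map_comp_mapPred, Category.assoc]
  change _ ≫ _ ≫ mapPred L (mem (fst A X) (snd A X ≫ comprehension P)) = _ ↔ _
  rw [mem_comprehension, lift_fst_snd, Category.id_comp]

/-- By Leibniz, `a = b` entails that every `S` containing `a` contains `b`; the image of this
entailment is applied to the singleton of `a`. -/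
lemma comp_map_eq_of_mapPred_eqPred {A X : E} {a b : X ⟶ A} {T : F} {x : T ⟶ L.obj X}
    (h : x ≫ mapPred L (eqPred a b) = tt T) : x ≫ L.map a = x ≫ L.map b := by
  let singleton : T ⟶ Pow (L.obj A) := comprehension (eqPred (snd _ _ ≫ x ≫ L.map a) (fst _ _))
  have mem_singleton : ∀ c, mem c singleton = tt T ↔ x ≫ L.map a = c := fun c => by
    rw [← Category.id_comp singleton, mem_comprehension, comp_eqPred_eq_tt_iff, lift_fst,
      lift_snd_assoc, Category.id_comp]
  let y : T ⟶ L.obj (X ⊗ Pow A) := lift x (singleton ≫ inv (powHom L A)) ≫ kappa L _ _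
  have y_fst : y ≫ L.map (fst _ _) = x := by
    simp only [y, Category.assoc, kappa_map_fst, lift_fst]
  have y_mem : ∀ c : X ⟶ A, y ≫ mapPred L (mem (fst _ _ ≫ c) (snd _ _)) =
      mem (x ≫ L.map c) singleton := fun c => by
    rw [mapPred_mem, comp_mem, L.map_comp, ← Category.assoc, y_fst]
    simp only [y, Category.assoc, kappa_map_snd_assoc, lift_snd_assoc, IsIso.inv_hom_id,
      Category.comp_id]
  rw [← mem_singleton, ← y_mem]
  refine comp_mapPred_of_entails₂ L (φ₁ := fst _ _ ≫ eqPred a b) (fun T p h₁ h₂ => ?_) ?_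
    ((y_mem a).trans ((mem_singleton _).2 rfl))
  · rw [← Category.assoc, comp_eqPred_eq_tt_iff] at h₁
    rw [comp_mem, ← Category.assoc] at h₂ ⊢
    rwa [← h₁]
  · rw [← map_comp_mapPred, ← Category.assoc, y_fst, h]

lemma mapPred_eqPred {A X : E} (a b : X ⟶ A) :
    mapPred L (eqPred a b) = eqPred (L.map a) (L.map b) := by
  refine omega_ext fun T x => ?_
  rw [comp_eqPred_eq_tt_iff]
  refine ⟨comp_map_eq_of_mapPred_eqPred L, fun h => ?_⟩
  have eqPred_self : eqPred b b = tt X := by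
    rw [← Category.id_comp (eqPred b b), comp_eqPred_eq_tt_iff]
  have map_lift_eq : x ≫ L.map (lift a b) = x ≫ L.map (lift b b) := by
    rw [comp_map_lift, h, ← comp_map_lift]
  rw [comp_mapPred_eq_tt_iff, ← eqPred_self, eqPred, eqPred, L.map_comp, L.map_comp,
    ← Category.assoc, map_lift_eq, Category.assoc]

lemma mapPred_forallImp {A X : E} (θ φ : A ⊗ X ⟶ Ω E) :
    mapPred L (forallImp θ φ) =
      forallImp (kappa L A X ≫ mapPred L θ) (kappa L A X ≫ mapPred L φ) := by
  rw [forallImp, mapPred_eqPred, ← eqPred_comp_mono _ _ (powHom L A), map_comprehension,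
    map_comprehension, mapPred_conj, comp_conj, forallImp]

lemma comp_mapPred_forallImp_iff {A X : E} {T : F} (x : T ⟶ L.obj X) (θ φ : A ⊗ X ⟶ Ω E) :
    x ≫ mapPred L (forallImp θ φ) = tt T ↔ ∀ (V : F) (f : V ⟶ T) (a : V ⟶ L.obj A),
      (lift a (f ≫ x) ≫ kappa L A X) ≫ mapPred L θ = tt V →
        (lift a (f ≫ x) ≫ kappa L A X) ≫ mapPred L φ = tt V := by
  simp only [mapPred_forallImp, comp_forallImp_eq_tt_iff, Category.assoc]

end LogicalFunctor

namespace QuantaleData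

section Joins

variable {E : Type u} [Category.{v} E] [ElementaryTopos E] {Q : QuantaleData E}

lemma comp_le_eq_tt_iff {X T : E} (p : T ⟶ X) (x y : X ⟶ Q.carrier) :
    p ≫ lift x y ≫ Q.le = tt T ↔ Q.Le (p ≫ x) (p ≫ y) := by
  rw [← Category.assoc, comp_lift, Le]

lemma forall_mem_le_iff_elt {X : E} (a z : X ⟶ Q.carrier) (S : X ⟶ Pow Q.carrier) :
    (∀ (Y : E) (f : Y ⟶ X) (s : Y ⟶ Q.carrier), mem s (f ≫ S) = tt Y →
      Q.Le (Q.m (f ≫ a) s) (f ≫ z)) ↔ Q.Le (Q.m (idx S ≫ a) (elt S)) (idx S ≫ z) := by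
  refine ⟨fun h => h _ _ _ (mem_elt S), fun h Y f s hs => ?_⟩
  obtain ⟨e, rfl, rfl⟩ := exists_elements hs
  simpa only [comp_m, Category.assoc] using h.comp e

lemma forall_mem_inImage_le_iff {I X : E} (q : I ⟶ Q.carrier) (f : I ⟶ X) (z : X ⟶ Q.carrier) :
    (∀ (Y : E) (g : Y ⟶ X) (s : Y ⟶ Q.carrier),
      mem s (g ≫ comprehension (inImage (lift q f))) = tt Y → Q.Le s (g ≫ z)) ↔
        Q.Le q (f ≫ z) := by
  refine ⟨fun h => h I f q ?_, fun h Y g s hs => ?_⟩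
  · simpa only [mem_comprehension, Category.id_comp] using self_comp_inImage (lift q f) (𝟙 I)
  · rw [mem_comprehension] at hs
    refine inImage_elim _ _ hs _ fun T t i hi => ?_
    have s_eq : t ≫ s = i ≫ q := by simpa only [Category.assoc, lift_fst] using hi =≫ fst _ _
    have g_eq : t ≫ g = i ≫ f := by simpa only [Category.assoc, lift_snd] using hi =≫ snd _ _
    rw [comp_le_eq_tt_iff, s_eq, ← Category.assoc, g_eq, Category.assoc]
    exact h.comp i

lemma IsCommQuantale.of_m_sup_le_iff (le_refl : ∀ {X : E} (x : X ⟶ Q.carrier), Q.Le x x)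
    (le_trans : ∀ {X : E} (x y z : X ⟶ Q.carrier), Q.Le x y → Q.Le y z → Q.Le x z)
    (le_antisymm : ∀ {X : E} (x y : X ⟶ Q.carrier), Q.Le x y → Q.Le y x → x = y)
    (mul_assoc : ∀ {X : E} (x y z : X ⟶ Q.carrier), Q.m (Q.m x y) z = Q.m x (Q.m y z))
    (one_mul : ∀ {X : E} (x : X ⟶ Q.carrier), Q.m (Q.one X) x = x)
    (mul_comm : ∀ {X : E} (x y : X ⟶ Q.carrier), Q.m x y = Q.m y x)
    (m_sup_le_iff : ∀ {X : E} (a : X ⟶ Q.carrier) (S : X ⟶ Pow Q.carrier) (z : X ⟶ Q.carrier),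
      Q.Le (Q.m a (S ≫ Q.sup)) z ↔ ∀ (Y : E) (f : Y ⟶ X) (s : Y ⟶ Q.carrier),
        mem s (f ≫ S) = tt Y → Q.Le (Q.m (f ≫ a) s) (f ≫ z)) :
    Q.IsCommQuantale := by
  have sup_le_iff : ∀ {X : E} (S : X ⟶ Pow Q.carrier) (z : X ⟶ Q.carrier),
      Q.Le (S ≫ Q.sup) z ↔ ∀ (Y : E) (f : Y ⟶ X) (s : Y ⟶ Q.carrier),
        mem s (f ≫ S) = tt Y → Q.Le s (f ≫ z) := fun {X} S z => by
    simpa only [comp_one, one_mul] using m_sup_le_iff (Q.one X) S z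
  have mul_sup : ∀ {X : E} (a : X ⟶ Q.carrier) (S : X ⟶ Pow Q.carrier),
      Q.m a (S ≫ Q.sup) = Q.join (Q.m (idx S ≫ a) (elt S)) (idx S) := fun a S => by
    have same_bounds : ∀ z, Q.Le (Q.m a (S ≫ Q.sup)) z ↔
        Q.Le (Q.join (Q.m (idx S ≫ a) (elt S)) (idx S)) z := fun z => by
      rw [m_sup_le_iff, forall_mem_le_iff_elt, join, sup_le_iff, forall_mem_inImage_le_iff]
    exact le_antisymm _ _ ((same_bounds _).2 (le_refl _)) ((same_bounds _).1 (le_refl _))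
  exact
    { le_refl := le_refl
      le_trans := le_trans
      le_antisymm := le_antisymm
      sup_le_iff := sup_le_iff
      mul_assoc := mul_assoc
      one_mul := one_mul
      mul_one := fun x => by rw [mul_comm, one_mul]
      mul_sup := mul_sup
      sup_mul := fun S a => by rw [mul_comm, mul_sup, mul_comm]
      mul_comm := mul_comm }

variable [Q.IsCommQuantale]

lemma join_le_iff_le_comp {I X : E} (q : I ⟶ Q.carrier) (f : I ⟶ X) (z : X ⟶ Q.carrier) :
    Q.Le (Q.join q f) z ↔ Q.Le q (f ≫ z) := by
  rw [join, sup_le_iff', forall_mem_inImage_le_iff]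

lemma iso_hom_comp_join {I X Y : E} (q : I ⟶ Q.carrier) (f : I ⟶ X) (y : Y ≅ X) :
    y.hom ≫ Q.join q f = Q.join q (f ≫ y.inv) := by
  refine eq_of_le_iff fun z => ?_
  have le_iff : Q.Le (y.hom ≫ Q.join q f) z ↔ Q.Le (Q.join q f) (y.inv ≫ z) :=
    ⟨fun h => by simpa using h.comp y.inv, fun h => by simpa using h.comp y.hom⟩
  rw [le_iff, join_le_iff_le_comp, join_le_iff_le_comp, Category.assoc]

lemma join_epi_comp {I J X : E} (e : J ⟶ I) [Epi e] (q : I ⟶ Q.carrier)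
    (f : I ⟶ X) : Q.join (e ≫ q) (e ≫ f) = Q.join q f :=
  eq_of_le_iff fun z => by
    rw [join_le_iff_le_comp, join_le_iff_le_comp, Category.assoc, ← comp_le_eq_tt_iff,
      ← comp_tt e, cancel_epi, Le]

lemma lift_m_sup_le {X : E} (a : X ⟶ Q.carrier) (S : X ⟶ Pow Q.carrier) (z : X ⟶ Q.carrier) :
    lift (Q.m a (S ≫ Q.sup)) z ≫ Q.le = forallImp (mem (fst _ _) (snd _ _ ≫ S))
      (lift (Q.m (snd _ _ ≫ a) (fst _ _)) (snd _ _ ≫ z) ≫ Q.le) :=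
  omega_ext fun T p => by
    rw [comp_le_eq_tt_iff, comp_m, ← Category.assoc, m_sup_le_iff, comp_forallImp_eq_tt_iff]
    simp only [comp_mem, comp_le_eq_tt_iff, comp_m, lift_fst, lift_snd_assoc, Category.assoc]

lemma lift_join_le {I X : E} (q : I ⟶ Q.carrier) (f : I ⟶ X) {Y : E} (y : Y ⟶ X)
    (z : Y ⟶ Q.carrier) :
    lift (y ≫ Q.join q f) z ≫ Q.le = forallImp (eqPred (fst _ _ ≫ f) (snd _ _ ≫ y))
      (lift (fst _ _ ≫ q) (snd _ _ ≫ z) ≫ Q.le) :=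
  omega_ext fun T p => by
    rw [comp_le_eq_tt_iff, ← Category.assoc, join_le_iff, comp_forallImp_eq_tt_iff]
    simp only [comp_eqPred_eq_tt_iff, comp_le_eq_tt_iff, lift_fst_assoc, lift_snd_assoc,
      Category.assoc]

end Joins

section LogicalFunctor

variable {E : Type u₁} [Category.{v₁} E] [ElementaryTopos E] {F : Type u₂} [Category.{v₂} F]
  [ElementaryTopos F] (L : E ⥤ F)

lemma exists_comp_map₂ [PreservesFiniteProducts L] {A B : E} {T : F} (a : T ⟶ L.obj A)
    (b : T ⟶ L.obj B) :
    ∃ p : T ⟶ L.obj (A ⊗ B), a = p ≫ L.map (fst _ _) ∧ b = p ≫ L.map (snd _ _) :=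
  ⟨lift a b ≫ kappa L A B, by rw [Category.assoc, kappa_map_fst, lift_fst],
    by rw [Category.assoc, kappa_map_snd, lift_snd]⟩

lemma exists_comp_map₃ [PreservesFiniteProducts L] {A B C : E} {T : F} (a : T ⟶ L.obj A)
    (b : T ⟶ L.obj B) (c : T ⟶ L.obj C) :
    ∃ p : T ⟶ L.obj (A ⊗ (B ⊗ C)), a = p ≫ L.map (fst _ _) ∧
      b = p ≫ L.map (snd _ _ ≫ fst _ _) ∧ c = p ≫ L.map (snd _ _ ≫ snd _ _) := by
  obtain ⟨q, rfl, rfl⟩ := exists_comp_map₂ L b c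
  obtain ⟨p, rfl, rfl⟩ := exists_comp_map₂ L a q
  exact ⟨p, rfl, by rw [L.map_comp, Category.assoc], by rw [L.map_comp, Category.assoc]⟩

variable [IsLogical L] (Q : QuantaleData E)

lemma map_m_comp {X : E} {T : F} (p : T ⟶ L.obj X) (x y : X ⟶ Q.carrier) :
    (Q.map L).m (p ≫ L.map x) (p ≫ L.map y) = p ≫ L.map (Q.m x y) := by
  rw [map_m, comp_m]

lemma comp_powHom_map_sup {T : F} (S : T ⟶ L.obj (Pow Q.carrier)) :
    (S ≫ powHom L Q.carrier) ≫ (Q.map L).sup = S ≫ L.map Q.sup := by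
  rw [Category.assoc, IsIso.hom_inv_id_assoc]

lemma comp_mapPred_le_iff {X : E} {T : F} (p : T ⟶ L.obj X) (x y : X ⟶ Q.carrier) :
    p ≫ mapPred L (lift x y ≫ Q.le) = tt T ↔ (Q.map L).Le (p ≫ L.map x) (p ≫ L.map y) := by
  rw [Le, mapPred, L.map_comp, Category.assoc, ← Category.assoc, comp_map_lift, Category.assoc]

variable [Q.IsCommQuantale]

lemma map_m_sup_le_iff {X : F} (a : X ⟶ L.obj Q.carrier) (S : X ⟶ Pow (L.obj Q.carrier))
    (z : X ⟶ L.obj Q.carrier) :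
    (Q.map L).Le ((Q.map L).m a (S ≫ (Q.map L).sup)) z ↔
      ∀ (Y : F) (f : Y ⟶ X) (s : Y ⟶ L.obj Q.carrier),
        mem s (f ≫ S) = tt Y → (Q.map L).Le ((Q.map L).m (f ≫ a) s) (f ≫ z) := by
  obtain ⟨S, rfl⟩ : ∃ S' : X ⟶ L.obj (Pow Q.carrier), S = S' ≫ powHom L Q.carrier :=
    ⟨S ≫ inv (powHom L Q.carrier), by rw [Category.assoc, IsIso.inv_hom_id, Category.comp_id]⟩
  obtain ⟨p, rfl, rfl, rfl⟩ := exists_comp_map₃ L a S z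
  rw [comp_powHom_map_sup, Category.assoc, ← L.map_comp, map_m_comp, ← comp_mapPred_le_iff,
    lift_m_sup_le, comp_mapPred_forallImp_iff]
  simp only [comp_mapPred_le_iff, mapPred_mem, comp_mem, ← map_m_comp]
  simp only [L.map_comp, Category.assoc, kappa_map_fst, kappa_map_snd_assoc, lift_fst,
    lift_snd_assoc]

instance IsCommQuantale.map : (Q.map L).IsCommQuantale := by
  refine IsCommQuantale.of_m_sup_le_iff (fun x => ?_) (fun x y z => ?_) (fun x y => ?_)
    (fun x y z => ?_) (fun x => ?_) (fun x y => ?_) (map_m_sup_le_iff L Q)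
  · simpa only [L.map_id, Category.comp_id] using (Le.map L (le_refl (𝟙 Q.carrier))).comp x
  · obtain ⟨p, rfl, rfl, rfl⟩ := exists_comp_map₃ L x y z
    simp only [← comp_mapPred_le_iff]
    refine comp_mapPred_of_entails₂ L fun T t h₁ h₂ => ?_
    rw [comp_le_eq_tt_iff] at h₁ h₂ ⊢
    exact h₁.trans h₂
  · obtain ⟨p, rfl, rfl⟩ := exists_comp_map₂ L x y
    rw [← comp_mapPred_le_iff, ← comp_mapPred_le_iff, ← comp_eqPred_eq_tt_iff, ← mapPred_eqPred]
    refine comp_mapPred_of_entails₂ L fun T t h₁ h₂ => ?_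
    rw [comp_le_eq_tt_iff] at h₁ h₂
    exact (comp_eqPred_eq_tt_iff _ _ _).2 (IsQuantale.le_antisymm _ _ h₁ h₂)
  · obtain ⟨p, rfl, rfl, rfl⟩ := exists_comp_map₃ L x y z
    simp only [map_m_comp, IsQuantale.mul_assoc]
  · have h := map_m_comp L Q x (Q.one _) (𝟙 _)
    rw [one_m, map_one, comp_one] at h
    simpa only [L.map_id, Category.comp_id] using h
  · obtain ⟨p, rfl, rfl⟩ := exists_comp_map₂ L x y
    rw [map_m_comp, map_m_comp, m_comm]

lemma map_join {I X : E} (q : I ⟶ Q.carrier) (f : I ⟶ X) :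
    L.map (Q.join q f) = (Q.map L).join (L.map q) (L.map f) := by
  refine eq_of_le_iff (Q := Q.map L) fun z => ?_
  obtain ⟨p, hp, rfl⟩ := exists_comp_map₂ L (𝟙 (L.obj X)) z
  have map_join_eq : L.map (Q.join q f) = p ≫ L.map (fst _ _ ≫ Q.join q f) := by
    rw [L.map_comp, ← Category.assoc, ← hp, Category.id_comp]
  rw [map_join_eq, ← comp_mapPred_le_iff, lift_join_le, comp_mapPred_forallImp_iff,
    ← Category.id_comp (join _ _ _), join_le_iff]
  simp only [comp_mapPred_le_iff, mapPred_eqPred, comp_eqPred_eq_tt_iff]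
  simp only [L.map_comp, Category.assoc, kappa_map_fst_assoc, kappa_map_snd_assoc, lift_fst_assoc,
    lift_snd_assoc, ← hp]

end LogicalFunctor

end QuantaleData

section FiniteProducts

variable {E : Type u₁} [Category.{v₁} E] [ElementaryTopos E] {F : Type u₂} [Category.{v₂} F]
  [ElementaryTopos F] (L : E ⥤ F) [PreservesFiniteProducts L]

/-- The canonical isomorphism `L A ⊗ L B ≅ L (A ⊗ B)`. -/
def kappaIso (A B : E) : L.obj A ⊗ L.obj B ≅ L.obj (A ⊗ B) :=
  (asIso (prodComparison L A B)).symm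

lemma kappaIso_hom (A B : E) : (kappaIso L A B).hom = kappa L A B := rfl

lemma kappaIso_inv (A B : E) : (kappaIso L A B).inv = prodComparison L A B := rfl

/-- The canonical isomorphism `𝟙_ F ≅ L (𝟙_ E)`. -/
def unitIso : 𝟙_ F ≅ L.obj (𝟙_ E) := (asIso (terminalComparison L)).symm

/-- The monoidal structure of a functor preserving finite products, with tensorator `kappa L` and
unit `unitIso L`; it provides the coherence laws of these isomorphisms. -/
def coreMonoidal : L.CoreMonoidal :=
  letI := Functor.OplaxMonoidal.ofChosenFiniteProducts L
  haveI : IsIso (Functor.OplaxMonoidal.η L) := inferInstanceAs (IsIso (terminalComparison L))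
  haveI : ∀ A B, IsIso (Functor.OplaxMonoidal.δ L A B) := fun A B =>
    inferInstanceAs (IsIso (prodComparison L A B))
  .ofOplaxMonoidal L

lemma kappa_associativity (A B C : E) :
    kappa L A B ▷ L.obj C ≫ kappa L (A ⊗ B) C ≫ L.map (α_ A B C).hom =
      (α_ (L.obj A) (L.obj B) (L.obj C)).hom ≫ L.obj A ◁ kappa L B C ≫ kappa L A (B ⊗ C) :=
  (coreMonoidal L).associativity A B C

lemma kappa_left_unitality (A : E) :
    (λ_ (L.obj A)).hom = (unitIso L).hom ▷ L.obj A ≫ kappa L (𝟙_ E) A ≫ L.map (λ_ A).hom :=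
  (coreMonoidal L).left_unitality A

lemma kappa_right_unitality (A : E) :
    (ρ_ (L.obj A)).hom = L.obj A ◁ (unitIso L).hom ≫ kappa L A (𝟙_ E) ≫ L.map (ρ_ A).hom :=
  (coreMonoidal L).right_unitality A

lemma kappa_map_swap (A B : E) :
    kappa L A B ≫ L.map (swapIso A B).hom = (swapIso (L.obj A) (L.obj B)).hom ≫ kappa L B A := by
  rw [swapIso_hom, comp_map_lift, kappa_map_fst, kappa_map_snd, swapIso_hom]

lemma unitIso_comp_hom {G : Type u₃} [Category.{v₃} G] [ElementaryTopos G] (K : F ⥤ G)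
    [PreservesFiniteProducts K] :
    (unitIso (L ⋙ K)).hom = (unitIso K).hom ≫ K.map (unitIso L).hom :=
  inv_eq_of_eq_map_comp K (terminalComparison L) (terminalComparison K)
    (terminalComparison (L ⋙ K)) (Subsingleton.elim _ _)

end FiniteProducts

section Algebras

variable {S : Signature.{w}} {E : Type u₁} [Category.{v₁} E] [ElementaryTopos E] {F : Type u₂}
  [Category.{v₂} F] [ElementaryTopos F] (L : E ⥤ F) [PreservesFiniteProducts L]

lemma Algebra.IsHom.inv {A B : Algebra S E} {f : A.carrier ≅ B.carrier} (hf : A.IsHom B f.hom) :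
    B.IsHom A f.inv := by
  intro σ X b
  have h := hf σ X fun i => b i ≫ f.inv
  rw [← cancel_mono f.hom]
  simpa using h.symm

lemma Algebra.IsHom.map {A B : Algebra S E} {f : A.carrier ⟶ B.carrier} (hf : A.IsHom B f) :
    (A.map L).IsHom (B.map L) (L.map f) := by
  intro σ X a
  let π (i : Fin (S.arity σ)) : (∏ᶜ fun _ => A.carrier) ⟶ A.carrier := Pi.π _ i
  have lift_comp_kappaPow : Pi.lift (fun i => a i ≫ L.map f) ≫ kappaPow L _ B.carrier =
      Pi.lift a ≫ kappaPow L _ A.carrier ≫ L.map (Pi.lift fun i => π i ≫ f) := by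
    rw [← piLift_map_kappaPow, ← Category.assoc, ← Category.assoc]
    congr 1
    ext i
    simp only [π, L.map_comp, Category.assoc, Pi.lift_π]
    rw [← Category.assoc (kappaPow _ _ _), kappaPow_map_π, ← Category.assoc, Pi.lift_π]
  have op_comp : A.op σ ≫ f = Pi.lift (fun i => π i ≫ f) ≫ B.op σ := by
    have lift_π : Pi.lift π = 𝟙 _ := by ext i; simp [π]
    simpa only [lift_π, Category.id_comp] using hf σ _ π
  rw [← Category.assoc (Pi.lift _) (kappaPow _ _ _), lift_comp_kappaPow, Category.assoc,
    Category.assoc, Category.assoc, ← L.map_comp, ← L.map_comp, op_comp]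

lemma isHom_prodComparison (A B : Algebra S E) :
    ((A.prod B).map L).IsHom ((A.map L).prod (B.map L)) (prodComparison L A.carrier B.carrier) :=
  ((Algebra.isHom_fst A B).map L).lift ((Algebra.isHom_snd A B).map L)

lemma isHom_kappa (A B : Algebra S E) :
    ((A.map L).prod (B.map L)).IsHom ((A.prod B).map L) (kappa L A.carrier B.carrier) :=
  Algebra.IsHom.inv (A := (A.prod B).map L) (B := (A.map L).prod (B.map L))
    (f := (kappaIso L A.carrier B.carrier).symm) (isHom_prodComparison L A B)

lemma isHom_terminalComparison :
    ((Algebra.unit S E).map L).IsHom (Algebra.unit S F) (terminalComparison L) :=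
  Algebra.isHom_toUnit _

lemma isHom_unitIso : (Algebra.unit S F).IsHom ((Algebra.unit S E).map L) (unitIso L).hom :=
  Algebra.IsHom.inv (A := (Algebra.unit S E).map L) (B := Algebra.unit S F)
    (f := (unitIso L).symm) (isHom_terminalComparison L)

lemma Algebra.map_id (A : Algebra S E) : A.map (𝟭 E) = A := by
  refine Algebra.ext rfl (heq_of_eq (funext fun σ => ?_))
  exact (congrArg (· ≫ A.op σ) (kappaPow_id _ _)).trans (Category.id_comp _)

lemma Algebra.map_comp {G : Type u₃} [Category.{v₃} G] [ElementaryTopos G] (A : Algebra S E)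
    (K : F ⥤ G) [PreservesFiniteProducts K] : A.map (L ⋙ K) = (A.map L).map K := by
  refine Algebra.ext rfl (heq_of_eq (funext fun σ => ?_))
  refine (congrArg (· ≫ K.map (L.map (A.op σ))) (kappaPow_comp L K _ _)).trans ?_
  rw [Category.assoc, ← K.map_comp]

end Algebras

section Relations

variable {E : Type u₁} [Category.{v₁} E] [ElementaryTopos E] {F : Type u₂} [Category.{v₂} F]
  [ElementaryTopos F] (L : E ⥤ F) [IsLogical L] {Q : QuantaleData E}

lemma ap_mapRel_comp_map {A B X : E} {T : F} (p : T ⟶ L.obj X) (R : A ⊗ B ⟶ Q.carrier)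
    (a : X ⟶ A) (b : X ⟶ B) :
    ap (Q := Q.map L) (mapRel L R) (p ≫ L.map a) (p ≫ L.map b) = p ≫ L.map (ap R a b) := by
  rw [map_ap, comp_ap]

lemma ap_mapRel_tensorRel {A B A' B' : E} {X : F} (R : A ⊗ B ⟶ Q.carrier)
    (R' : A' ⊗ B' ⟶ Q.carrier) (a : X ⟶ L.obj (A ⊗ A')) (b : X ⟶ L.obj (B ⊗ B')) :
    ap (Q := Q.map L) (mapRel L (tensorRel R R')) a b =
      (Q.map L).m
        (ap (Q := Q.map L) (mapRel L R) (a ≫ L.map (fst _ _)) (b ≫ L.map (fst _ _)))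
        (ap (Q := Q.map L) (mapRel L R') (a ≫ L.map (snd _ _)) (b ≫ L.map (snd _ _))) := by
  obtain ⟨p, rfl, rfl⟩ := exists_comp_map₂ L a b
  simp only [Category.assoc, ← L.map_comp, ap_mapRel_comp_map, map_m_comp, ap_tensorRel]

lemma mapRel_id {A B : E} (R : A ⊗ B ⟶ Q.carrier) : mapRel (𝟭 E) R = R :=
  (congrArg (· ≫ R) (kappa_id A B)).trans (Category.id_comp R)

lemma mapRel_comp {G : Type u₃} [Category.{v₃} G] [ElementaryTopos G] (K : F ⥤ G) [IsLogical K]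
    {A B : E} (R : A ⊗ B ⟶ Q.carrier) :
    mapRel (L ⋙ K) R = mapRel (Q := Q.map L) K (mapRel L R) := by
  rw [mapRel, mapRel, mapRel, kappa_comp, K.map_comp, Category.assoc]
  rfl

variable [Q.IsCommQuantale]

lemma mapRel_graphRel {A B : E} (f : A ⟶ B) :
    mapRel L (graphRel Q f) = graphRel (Q.map L) (L.map f) := by
  have graph_eq : L.map (lift (𝟙 A) f) ≫ (kappaIso L A B).inv = lift (𝟙 _) (L.map f) := by
    rw [Iso.comp_inv_eq, kappaIso_hom, ← L.map_id, lift_map_kappa]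
  rw [mapRel, graphRel, map_join, ← kappaIso_hom, iso_hom_comp_join, map_one, graph_eq, graphRel]

lemma mapRel_idRel (A : E) : mapRel L (idRel Q A) = idRel (Q.map L) (L.obj A) := by
  rw [idRel_eq_graphRel, mapRel_graphRel, L.map_id, idRel_eq_graphRel]

lemma mapRel_compRel {A B C : E} (R : A ⊗ B ⟶ Q.carrier) (R' : B ⊗ C ⟶ Q.carrier) :
    mapRel L (compRel R R') = compRel (Q := Q.map L) (mapRel L R) (mapRel L R') := by
  let e : L.obj A ⊗ (L.obj B ⊗ L.obj C) ≅ L.obj (A ⊗ (B ⊗ C)) :=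
    whiskerLeftIso (L.obj A) (kappaIso L B C) ≪≫ kappaIso L A (B ⊗ C)
  have e_fst : e.hom ≫ L.map (fst _ _) = fst _ _ := by simp [e, kappaIso_hom, kappa_map_fst]
  have e_snd : e.hom ≫ L.map (snd _ _) = snd _ _ ≫ kappa L B C := by
    simp [e, kappaIso_hom, kappa_map_snd]
  have e_snd_fst : e.hom ≫ L.map (snd _ _ ≫ fst _ _) = snd _ _ ≫ fst _ _ := by
    rw [L.map_comp, ← Category.assoc, e_snd, Category.assoc, kappa_map_fst]
  have e_snd_snd : e.hom ≫ L.map (snd _ _ ≫ snd _ _) = snd _ _ ≫ snd _ _ := by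
    rw [L.map_comp, ← Category.assoc, e_snd, Category.assoc, kappa_map_snd]
  rw [mapRel, compRel, map_join, ← kappaIso_hom, iso_hom_comp_join]
  refine (join_epi_comp e.hom _ _).symm.trans ?_
  rw [← Category.assoc, ← map_m_comp, ← ap_mapRel_comp_map, ← ap_mapRel_comp_map, e_fst,
    e_snd_fst, e_snd_snd, compRel]
  congr 1
  rw [Iso.comp_inv_eq, kappaIso_hom, comp_map_lift, e_fst, e_snd_snd]

lemma mapRel_tensorRel_naturality {A B A' B' : E} (R : A ⊗ B ⟶ Q.carrier)
    (R' : A' ⊗ B' ⟶ Q.carrier) :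
    compRel (Q := Q.map L) (tensorRel (Q := Q.map L) (mapRel L R) (mapRel L R'))
        (graphRel (Q.map L) (kappa L B B')) =
      compRel (Q := Q.map L) (graphRel (Q.map L) (kappa L A A')) (mapRel L (tensorRel R R')) := by
  rw [graphRel_compRel, ← kappaIso_hom L B B', compRel_graphRel]
  refine rel_ext fun X a b => ?_
  rw [ap_whiskerLeft, ap_whiskerRight, ap_mapRel_tensorRel, ap_tensorRel, kappaIso_inv]
  simp only [Category.assoc, kappa_map_fst, kappa_map_snd,
    CartesianMonoidalCategory.prodComparison_fst, CartesianMonoidalCategory.prodComparison_snd]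

end Relations

namespace Rel

section Graphs

variable {S : Signature.{w}} {E : Type u} [Category.{v} E] [ElementaryTopos E]
  {Q : QuantaleData E} [Q.IsCommQuantale]

/-- The relation `R` is the graph of the morphism `f`. Keeping `f` out of the data of `R` spares
the proofs that the morphisms occurring in coherence laws are homomorphisms. -/
def IsGraph {A B : Rel S Q} (R : A ⟶ B) (f : A.alg.carrier ⟶ B.alg.carrier) : Prop :=
  rel R = graphRel Q f

lemma IsGraph.eq {A B : Rel S Q} {R R' : A ⟶ B} {f f' : A.alg.carrier ⟶ B.alg.carrier}
    (hR : IsGraph R f) (hR' : IsGraph R' f') (h : f = f') : R = R' :=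
  hom_ext (hR.trans ((congrArg (graphRel Q) h).trans hR'.symm))

lemma isGraph_id (A : Rel S Q) : IsGraph (𝟙 A) (𝟙 A.alg.carrier) := rfl

lemma IsGraph.comp {A B C : Rel S Q} {R : A ⟶ B} {R' : B ⟶ C} {f : A.alg.carrier ⟶ B.alg.carrier}
    {g : B.alg.carrier ⟶ C.alg.carrier} (hR : IsGraph R f) (hR' : IsGraph R' g) :
    IsGraph (R ≫ R') (f ≫ g) := by
  rw [IsGraph, rel_comp, hR, hR', graphRel_comp]

lemma IsGraph.tensorHom {A A' B B' : Rel S Q} {R : A ⟶ B} {R' : A' ⟶ B'}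
    {f : A.alg.carrier ⟶ B.alg.carrier} {f' : A'.alg.carrier ⟶ B'.alg.carrier}
    (hR : IsGraph R f) (hR' : IsGraph R' f') : IsGraph (R ⊗ₘ R') (f ⊗ₘ f') :=
  (congrArg₂ tensorRel hR hR').trans (tensorRel_graphRel f f')

lemma IsGraph.whiskerRight {A B : Rel S Q} {R : A ⟶ B} {f : A.alg.carrier ⟶ B.alg.carrier}
    (hR : IsGraph R f) (C : Rel S Q) : IsGraph (R ▷ C) (f ▷ C.alg.carrier) := by
  rw [← tensorHom_id, ← tensorHom_id]
  exact hR.tensorHom (isGraph_id C)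

lemma IsGraph.whiskerLeft {A B : Rel S Q} {R : A ⟶ B} {f : A.alg.carrier ⟶ B.alg.carrier}
    (C : Rel S Q) (hR : IsGraph R f) : IsGraph (C ◁ R) (C.alg.carrier ◁ f) := by
  rw [← id_tensorHom, ← id_tensorHom]
  exact (isGraph_id C).tensorHom hR

lemma isGraph_associator_hom (A B C : Rel S Q) :
    IsGraph (α_ A B C).hom (α_ A.alg.carrier B.alg.carrier C.alg.carrier).hom := rfl

lemma isGraph_leftUnitor_hom (A : Rel S Q) : IsGraph (λ_ A).hom (λ_ A.alg.carrier).hom := rfl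

lemma isGraph_rightUnitor_hom (A : Rel S Q) : IsGraph (ρ_ A).hom (ρ_ A.alg.carrier).hom := rfl

lemma isGraph_braiding_hom (A B : Rel S Q) :
    IsGraph (β_ A B).hom (swapIso A.alg.carrier B.alg.carrier).hom := rfl

end Graphs

section Induced

variable (S : Signature.{w}) {E : Type u₁} [Category.{v₁} E] [ElementaryTopos E] {F : Type u₂}
  [Category.{v₂} F] [ElementaryTopos F] (L : E ⥤ F) [IsLogical L] (Q : QuantaleData E)
  [Q.IsCommQuantale] (Q' : QuantaleData F) [Q'.IsCommQuantale] (h : Q.map L = Q')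

lemma rel_relMap_map {A B : Rel S Q} (R : A ⟶ B) :
    rel ((relMap S L Q (Q.map L) rfl).map R) = mapRel L (rel R) :=
  Category.comp_id _

/-- The functor underlying `L^*`. -/
def mapFunctor : Rel S Q ⥤ Rel S Q' where
  __ := relMap S L Q Q' h
  map_id A := by
    subst h
    exact hom_ext ((rel_relMap_map S L Q _).trans (mapRel_idRel L A.alg.carrier))
  map_comp R R' := by
    subst h
    refine hom_ext ?_
    rw [rel_relMap_map, rel_comp, rel_comp, rel_relMap_map, rel_relMap_map]
    exact mapRel_compRel L (rel R) (rel R')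

variable {S L Q Q'}

lemma IsGraph.map {A B : Rel S Q} {R : A ⟶ B} {f : A.alg.carrier ⟶ B.alg.carrier}
    (hR : IsGraph R f) : IsGraph ((mapFunctor S L Q Q' h).map R) (L.map f) := by
  subst h
  exact (rel_relMap_map S L Q R).trans ((congrArg (mapRel L) hR).trans (mapRel_graphRel L f))

variable (L) in
/-- The tensorator of `L^*`. -/
def mapTensorIso (A B : Rel S Q) :
    (mapFunctor S L Q Q' h).obj A ⊗ (mapFunctor S L Q Q' h).obj B ≅
      (mapFunctor S L Q Q' h).obj (A ⊗ B) :=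
  graphIso (kappaIso L A.alg.carrier B.alg.carrier) (isHom_kappa L A.alg B.alg)
    (isHom_prodComparison L A.alg B.alg)

lemma isGraph_mapTensorIso_hom (A B : Rel S Q) :
    IsGraph (mapTensorIso L h A B).hom (kappa L A.alg.carrier B.alg.carrier) := rfl

variable (S L Q Q') in
/-- The unit comparison of `L^*`. -/
def mapUnitIso : 𝟙_ (Rel S Q') ≅ (mapFunctor S L Q Q' h).obj (𝟙_ (Rel S Q)) :=
  graphIso (unitIso L) (isHom_unitIso L) (isHom_terminalComparison L)

lemma isGraph_mapUnitIso_hom :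
    IsGraph (mapUnitIso S L Q Q' h).hom (unitIso L).hom := rfl

lemma mapTensorIso_hom_naturality {A B A' B' : Rel S Q} (R : A ⟶ B) (R' : A' ⟶ B') :
    ((mapFunctor S L Q Q' h).map R ⊗ₘ (mapFunctor S L Q Q' h).map R') ≫
        (mapTensorIso L h B B').hom =
      (mapTensorIso L h A A').hom ≫ (mapFunctor S L Q Q' h).map (R ⊗ₘ R') := by
  subst h
  refine hom_ext (Eq.trans ?_ ((mapRel_tensorRel_naturality L (rel R) (rel R')).trans ?_))
  · exact congrArg₂ (fun T T' => compRel (tensorRel T T') (graphRel (Q.map L) (kappa L _ _)))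
      (rel_relMap_map S L Q R) (rel_relMap_map S L Q R')
  · exact congrArg (compRel (graphRel (Q.map L) (kappa L _ _)))
      (rel_relMap_map S L Q (R ⊗ₘ R')).symm

variable (S L Q Q') in
/-- The monoidal structure of `L^*`. -/
def mapCoreMonoidal : (mapFunctor S L Q Q' h).CoreMonoidal where
  εIso := mapUnitIso S L Q Q' h
  μIso := mapTensorIso L h
  μIso_hom_natural_left R C := by
    rw [← tensorHom_id, ← tensorHom_id, ← CategoryTheory.Functor.map_id]
    exact mapTensorIso_hom_naturality h R (𝟙 C)
  μIso_hom_natural_right C R := by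
    rw [← id_tensorHom, ← id_tensorHom, ← CategoryTheory.Functor.map_id]
    exact mapTensorIso_hom_naturality h (𝟙 C) R
  associativity A B C :=
    (((isGraph_mapTensorIso_hom h A B).whiskerRight _).comp
      ((isGraph_mapTensorIso_hom h (A ⊗ B) C).comp ((isGraph_associator_hom A B C).map h))).eq
    ((isGraph_associator_hom _ _ _).comp
      (((isGraph_mapTensorIso_hom h B C).whiskerLeft _).comp
        (isGraph_mapTensorIso_hom h A (B ⊗ C))))
    (kappa_associativity L _ _ _)
  left_unitality A :=
    (isGraph_leftUnitor_hom _).eq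
      (((isGraph_mapUnitIso_hom h).whiskerRight _).comp
        ((isGraph_mapTensorIso_hom h _ A).comp ((isGraph_leftUnitor_hom A).map h)))
      (kappa_left_unitality L _)
  right_unitality A :=
    (isGraph_rightUnitor_hom _).eq
      (((isGraph_mapUnitIso_hom h).whiskerLeft _).comp
        ((isGraph_mapTensorIso_hom h A _).comp ((isGraph_rightUnitor_hom A).map h)))
      (kappa_right_unitality L _)

variable (S L Q Q') in
/-- The symmetric monoidal functor `L^*`. -/
def mapSymMonFunctor : SymMonFunctor (Rel S Q) (Rel S Q') where
  toFunctor := mapFunctor S L Q Q' h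
  braided :=
    { (mapCoreMonoidal S L Q Q' h).toMonoidal with
      braided A B :=
        ((isGraph_mapTensorIso_hom h A B).comp ((isGraph_braiding_hom A B).map h)).eq
          ((isGraph_braiding_hom _ _).comp (isGraph_mapTensorIso_hom h B A))
          (kappa_map_swap L _ _) }

end Induced

end Rel

section Functoriality

lemma SymMonFunctor.hext {C : Type u₁} [Category.{v₁} C] [MonoidalCategory C]
    [SymmetricCategory C] {D : Type u₂} [Category.{v₂} D] [MonoidalCategory D]
    [SymmetricCategory D] {G H : SymMonFunctor C D} (hobj : ∀ A, G.obj A = H.obj A)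
    (hmap : ∀ (A B : C) (f : A ⟶ B), G.map f ≍ H.map f) (hε : G.braided.ε ≍ H.braided.ε)
    (hμ : ∀ A B : C, G.braided.μ A B ≍ H.braided.μ A B) : G = H := by
  obtain ⟨G, bG⟩ := G
  obtain ⟨H, bH⟩ := H
  obtain rfl : G = H := CategoryTheory.Functor.hext hobj hmap
  have lax_eq : bG.toLaxMonoidal = bH.toLaxMonoidal := by
    ext A B
    · exact eq_of_heq hε
    · exact eq_of_heq (hμ A B)
  have monoidal_eq : bG.toMonoidal = bH.toMonoidal :=
    Functor.Monoidal.toLaxMonoidal_injective _ lax_eq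
  cases bG
  cases bH
  cases monoidal_eq
  rfl

namespace Rel

variable {S : Signature.{w}} {E : Type u₁} [Category.{v₁} E] [ElementaryTopos E] {F : Type u₂}
  [Category.{v₂} F] [ElementaryTopos F] {G : Type u₃} [Category.{v₃} G] [ElementaryTopos G]

lemma hom_heq {Q : QuantaleData E} [Q.IsCommQuantale] {A A' B B' : Rel S Q} {R : A ⟶ B}
    {R' : A' ⟶ B'} (hA : A = A') (hB : B = B') (h : rel R ≍ rel R') : R ≍ R' := by
  subst hA hB
  exact heq_of_eq (hom_ext (eq_of_heq h))

variable (S) in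
lemma mapSymMonFunctor_id (Q : QuantaleData E) [Q.IsCommQuantale] (h : Q.map (𝟭 E) = Q) :
    mapSymMonFunctor S (𝟭 E) Q Q h = SymMonFunctor.id (Rel S Q) := by
  have obj_eq : ∀ A : Rel S Q, ⟨A.alg.map (𝟭 E)⟩ = A := fun A => Rel.ext (Algebra.map_id A.alg)
  refine SymMonFunctor.hext obj_eq
    (fun A B R => hom_heq (obj_eq A) (obj_eq B) (heq_of_eq ?_))
    (hom_heq rfl (obj_eq _) (heq_of_eq ?_))
    (fun A B => hom_heq (congrArg₂ tensorObj (obj_eq A) (obj_eq B)) (obj_eq _) (heq_of_eq ?_))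
  · exact (rel_relMap_map S (𝟭 E) Q R).trans (mapRel_id (rel R))
  · exact congrArg (graphRel Q) (Subsingleton.elim (α := _ ⟶ 𝟙_ E) _ _)
  · exact congrArg (graphRel Q) (kappa_id A.alg.carrier B.alg.carrier)

variable (S) in
lemma mapSymMonFunctor_comp (L : E ⥤ F) [IsLogical L] (K : F ⥤ G) [IsLogical K]
    (Q : QuantaleData E) [Q.IsCommQuantale] (Q' : QuantaleData F) [Q'.IsCommQuantale]
    (Q'' : QuantaleData G) [Q''.IsCommQuantale]
    (h : Q.map L = Q') (h' : Q'.map K = Q'') (h'' : Q.map (L ⋙ K) = Q'') :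
    mapSymMonFunctor S (L ⋙ K) Q Q'' h'' =
      (mapSymMonFunctor S L Q Q' h).comp (mapSymMonFunctor S K Q' Q'' h') := by
  have obj_eq : ∀ A : Rel S Q, (⟨A.alg.map (L ⋙ K)⟩ : Rel S Q'') = ⟨(A.alg.map L).map K⟩ :=
    fun A => Rel.ext (Algebra.map_comp L A.alg K)
  refine SymMonFunctor.hext obj_eq
    (fun A B R => hom_heq (obj_eq A) (obj_eq B) (heq_of_eq ?_))
    (hom_heq rfl (obj_eq _) (heq_of_eq ?_))
    (fun A B => hom_heq (congrArg₂ tensorObj (obj_eq A) (obj_eq B)) (obj_eq _) (heq_of_eq ?_))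
  · subst h h'
    refine (rel_relMap_map S (L ⋙ K) Q R).trans ((mapRel_comp L K (rel R)).trans ?_)
    exact (congrArg (mapRel K) (rel_relMap_map S L Q R).symm).trans
      (rel_relMap_map S K (Q.map L) _).symm
  · exact (congrArg (graphRel Q'') (unitIso_comp_hom L K)).trans
      ((isGraph_mapUnitIso_hom h').comp ((isGraph_mapUnitIso_hom h).map h')).symm
  · exact (congrArg (graphRel Q'') (kappa_comp L K _ _)).trans
      ((isGraph_mapTensorIso_hom h' _ _).comp ((isGraph_mapTensorIso_hom h A B).map h')).symm

end Rel

end Functoriality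

end

end ToposRel

theorem mainTheorem9 (S : Signature.{w}) :
    (∀ {E : Type u} [Category.{v} E] [ElementaryTopos E] {F : Type u} [Category.{v} F]
      [ElementaryTopos F] (L : E ⥤ F) [IsLogical L] (Q : QuantaleData E),
      Q.IsCommQuantale → (Q.map L).IsCommQuantale) ∧
    ∃ star : ∀ {E : Type u} [Category.{v} E] [ElementaryTopos E] {F : Type u} [Category.{v} F]
        [ElementaryTopos F] (L : E ⥤ F) [IsLogical L]
        (Q : QuantaleData E) [Q.IsCommQuantale] (Q' : QuantaleData F) [Q'.IsCommQuantale],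
        Q.map L = Q' → SymMonFunctor (Rel S Q) (Rel S Q'),
      (∀ {E : Type u} [Category.{v} E] [ElementaryTopos E] {F : Type u} [Category.{v} F]
        [ElementaryTopos F] (L : E ⥤ F) [IsLogical L]
        (Q : QuantaleData E) [Q.IsCommQuantale] (Q' : QuantaleData F) [Q'.IsCommQuantale]
        (h : Q.map L = Q'),
        (star L Q Q' h).toPrefunctor = relMap S L Q Q' h) ∧
      (∀ {E : Type u} [Category.{v} E] [ElementaryTopos E]
        (Q : QuantaleData E) [Q.IsCommQuantale] (h : Q.map (𝟭 E) = Q),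
        star (𝟭 E) Q Q h = SymMonFunctor.id (Rel S Q)) ∧
      (∀ {E : Type u} [Category.{v} E] [ElementaryTopos E] {F : Type u} [Category.{v} F]
        [ElementaryTopos F] {G : Type u} [Category.{v} G] [ElementaryTopos G]
        (L : E ⥤ F) [IsLogical L] (K : F ⥤ G) [IsLogical K]
        (Q : QuantaleData E) [Q.IsCommQuantale] (Q' : QuantaleData F) [Q'.IsCommQuantale]
        (Q'' : QuantaleData G) [Q''.IsCommQuantale]
        (h : Q.map L = Q') (h' : Q'.map K = Q'') (h'' : Q.map (L ⋙ K) = Q''),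
        star (L ⋙ K) Q Q'' h'' = (star L Q Q' h).comp (star K Q' Q'' h')) := by
  refine ⟨fun L _ Q _ => QuantaleData.IsCommQuantale.map L Q,
    fun L _ Q _ Q' _ h => Rel.mapSymMonFunctor S L Q Q' h, ?_, ?_, ?_⟩
  · intros
    rfl
  · intro E _ _ Q _ h
    exact Rel.mapSymMonFunctor_id S Q h
  · intro E _ _ F _ _ G _ _ L _ K _ Q _ Q' _ Q'' _ h h' h''
    exact Rel.mapSymMonFunctor_comp S L K Q Q' Q'' h h' h''
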